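/- Let $k\ge 1$ and let $N_1,\dots,N_k\ge 2$ be integers; write $\mathbf N=(N_1,\dots,N_k)$. For an integer $N\ge 1$ let $r_1,\dots,r_{\varphi(N)}$ be the integers in $\{1,\dots,N\}$ coprime to $N$ ($\varphi$ is Euler's totient function), let $C_N=N^{\varphi(N)}\prod_{p\mid N}p^{\varphi(N)/(p-1)}$ (product over the primes dividing $N$), and for $m\ge 0$ put $$\mathbf B_N(m)=C_N^m\prod_{j=1}^{\varphi(N)}\frac{(r_j/N)_m}{m!},\qquad \mathbf H_N(m)=\sum_{j=1}^{\varphi(N)}H(r_j/N,m)-\varphi(N)H(1,m),$$ where $(x)_m=x(x+1)\cdots(x+m-1)$ and $H(x,m)=\sum_{n=0}^{m-1}\frac1{x+n}$. Put $C_{\mathbf N}=\prod_{j}C_{N_j}$, $\Phi_{\mathbf N}=\sum_j\varphi(N_j)$, $\mathbf B_{\mathbf N}(m)=\prod_j\mathbf B_{N_j}(m)$, $\mathbf H_{\mathbf N}(m)=\sum_j\mathbf H_{N_j}(m)$, and, for complex $z$ with $|z|<1/C_{\mathbf N}$, $$\mathbf F_{\mathbf N}(z)=\sum_{m\ge0}\mathbf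 B_{\mathbf N}(m)z^m,\qquad \mathbf G_{\mathbf N}(z)=\sum_{m\ge1}\mathbf H_{\mathbf N}(m)\mathbf B_{\mathbf N}(m)z^m,\qquad \mathbf q_{\mathbf N}(z)=z\exp\big(\mathbf G_{\mathbf N}(z)/\mathbf F_{\mathbf N}(z)\big).$$ Then the following assertions hold. (i) The function $\mathbf q_{\mathbf N}$ is the sum of its Taylor series at $0$ on the disk $|z|<1/C_{\mathbf N}$; the radius of convergence of this Taylor series is equal to $1/C_{\mathbf N}$, and the series converges (absolutely) for every $z$ with $|z|=1/C_{\mathbf N}$. (ii) The function $\mathbf q_{\mathbf N}$ has a singularity at $z=1/C_{\mathbf N}$: no function analytic at $1/C_{\mathbf N}$ agrees with $\mathbf q_{\mathbf N}$ at the points of the disk $|z|<1/C_{\mathbf N}$ close to $1/C_{\mathbf N}$. (iii) For every $z$ with $|z|\le 1/C_{\mathbf N}$ we have $|\mathbf q_{\mathbf N}(z)|\le 1$, where for $|z|=1/C_{\mathbf N}$ the value $\mathbf q_{\mathbf N}(z)$ is the sum of the Taylor series at $z$, which is also the limit of $\mathbf q_{\mathbf N}$ at $z$ from inside the disk. (iv)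 If $\Phi_{\mathbf N}=1$ (that is, $\mathbf N=(2)$), then for $m\ge1$ the $m$-th Taylor coefficient of $\mathbf q_{\mathbf N}$ at $0$ is equal to the Catalan number $\frac1{m+1}\binom{2m}{m}$, and, hence, as $m\to\infty$, it is equal to $\frac{4^m}{\sqrt\pi\,m^{3/2}}(1+o(1))$. (v) If $\Phi_{\mathbf N}=2$, then there is a non-zero real constant $c$ (depending on $\mathbf N$) such that, as $m\to\infty$, the $m$-th Taylor coefficient of $\mathbf q_{\mathbf N}$ at $0$ is equal to $c\,\frac{C_{\mathbf N}^m}{m\log^2(m)}(1+o(1))$. (vi) If $\Phi_{\mathbf N}\ge3$, then there is a non-zero real constant $c$ (depending on $\mathbf N$) such that, as $m\to\infty$, the $m$-th Taylor coefficient of $\mathbf q_{\mathbf N}$ at $0$ is equal to $c\,\frac{C_{\mathbf N}^m}{m^{\Phi_{\mathbf N}/2}}(1+o(1))$. -/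

import Mathlib

open Filter Topology Asymptotics

noncomputable section

namespace CanonicalCoordinate

/-- The integers in `{1, ..., n}` coprime to `n`; there are `φ(n)` of them. -/
def residues (n : ℕ) : Finset ℕ :=
  (Finset.Icc 1 n).filter (fun r => Nat.Coprime r n)

/-- `C_n = n ^ φ(n) * ∏_{p ∣ n} p ^ (φ(n) / (p - 1))`. For a prime `p ∣ n` the number `p - 1`
divides `φ(n)`, so the division is exact. -/
def C1 (n : ℕ) : ℕ :=
  n ^ n.totient * ∏ p ∈ n.primeFactors, p ^ (n.totient / (p - 1))

/-- `B_n(m) = C_n ^ m * ∏_r (r/n)_m / m!`, with `(x)_m = x (x + 1) ⋯ (x + m - 1)`. -/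
def B1 (n m : ℕ) : ℝ :=
  (C1 n : ℝ) ^ m *
    ∏ r ∈ residues n, (ascPochhammer ℝ m).eval ((r : ℝ) / (n : ℝ)) / (m.factorial : ℝ)

/-- `H(x, m) = ∑_{0 ≤ i < m} 1 / (x + i)`. -/
def harm (x : ℝ) (m : ℕ) : ℝ :=
  ∑ i ∈ Finset.range m, 1 / (x + (i : ℝ))

/-- `H_n(m) = ∑_r H(r/n, m) - φ(n) H(1, m)`. -/
def H1 (n m : ℕ) : ℝ :=
  ∑ r ∈ residues n, harm ((r : ℝ) / (n : ℝ)) m - (n.totient : ℝ) * harm 1 m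

/-- `C_N = C_{N_1} ⋯ C_{N_k}`. -/
def C {k : ℕ} (N : Fin k → ℕ) : ℕ := ∏ j, C1 (N j)

/-- `Φ_N = φ(N_1) + ⋯ + φ(N_k)`. -/
def Phi {k : ℕ} (N : Fin k → ℕ) : ℕ := ∑ j, (N j).totient

/-- `B_N(m) = B_{N_1}(m) ⋯ B_{N_k}(m)`. -/
def B {k : ℕ} (N : Fin k → ℕ) (m : ℕ) : ℝ := ∏ j, B1 (N j) m

/-- `H_N(m) = H_{N_1}(m) + ⋯ + H_{N_k}(m)`. -/
def H {k : ℕ} (N : Fin k → ℕ) (m : ℕ) : ℝ := ∑ j, H1 (N j) m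

/-- `F_N(z) = ∑_{m ≥ 0} B_N(m) z ^ m`, meant for `|z| < 1 / C_N`. -/
def F {k : ℕ} (N : Fin k → ℕ) (z : ℂ) : ℂ := ∑' m : ℕ, (B N m : ℂ) * z ^ m

/-- `G_N(z) = ∑_{m ≥ 1} H_N(m) B_N(m) z ^ m`, meant for `|z| < 1 / C_N`
(the term `m = 0` vanishes because `H_N(0) = 0`). -/
def G {k : ℕ} (N : Fin k → ℕ) (z : ℂ) : ℂ :=
  ∑' m : ℕ, (H N m : ℂ) * (B N m : ℂ) * z ^ m

/-- The canonical coordinate `q_N(z) = z exp(G_N(z) / F_N(z))`, meant for `|z| < 1 / C_N`. -/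
def q {k : ℕ} (N : Fin k → ℕ) (z : ℂ) : ℂ := z * Complex.exp (G N z / F N z)

/-- The `m`-th Taylor coefficient of a function at `0`. -/
def taylorCoeff (f : ℂ → ℂ) (m : ℕ) : ℂ := iteratedDeriv m f 0 / (m.factorial : ℂ)

/-- The Taylor series of a function at `0`. -/
def taylorSeries (f : ℂ → ℂ) : FormalMultilinearSeries ℂ ℂ ℂ :=
  FormalMultilinearSeries.ofScalars ℂ (taylorCoeff f)

/-- A function `f` on `D` has a singularity at the boundary point `z₀` of `D`: no function that is
analytic at `z₀` agrees with `f` on the part of `D` near `z₀`. -/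
def HasSingularityAt (f : ℂ → ℂ) (D : Set ℂ) (z₀ : ℂ) : Prop :=
  z₀ ∈ frontier D ∧ ¬ ∃ g : ℂ → ℂ, AnalyticAt ℂ g z₀ ∧ f =ᶠ[𝓝[D] z₀] g

end CanonicalCoordinate

end

/-! Rescaling by `z ↦ C_N z` turns the coefficients of `F` into b_n = ∏ (x_i)_n / n!, where the x_i
are the fractions r_j/N_l in (0,1), and those of `G` into h_n b_n. The sequence b is positive,
decreasing and log-convex, so by Kaluza's theorem 1/∑ b_n z^n = 1 - ∑ a_n z^n with a_n ≥ 0 and ∑ a_n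
≤ 1. The sequence h increases strictly from 0 to a limit L, and the coefficients of the quotient g =
G/F are g_n = ∑ a_k b_{n-k} (h_n - h_{n-k}) ≥ 0. Hence exp g has coefficients e_n ≥ 0. Since h_n ≤
L, g ≤ L on [0,1), so ∑ e_n ≤ exp L. A sieve computation gives L = log C_N, so the Taylor series of
q has non-negative coefficients with sum at most 1 at 1/C_N. This yields absolute convergence on the
circle, the boundary values and the bound by 1.

The asymptotics pass along the chain b, a, g, e by convolution estimates for slowly varying weights
w. If a_n ~ α w_n and (L - h_n) b_n = o(w_n), the identity g = L - (∑ (L - h_n) b_n z^n)(1 - ∑ a_n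
z^n) gives g_n ~ α D w_n with D = ∑ (L - h_n) b_n > 0, and z (exp g)' = z g' exp g gives e_n ~ α D
(∑ e_k) w_n. All constants are positive. By symmetry of the residues ∑ x_i = Φ/2, so Gauss's limit
gives b_n ~ κ n^(-Φ/2). For Φ ≥ 3 this weight is summable, and A' = B'/B² (A and B being the series
of a and b) transfers it from b to a (`tendsto_recip_of_summable`). For Φ = 2 the sums of b diverge
logarithmically, the tails 1 - a_0 - ⋯ - a_n are ~ 1/(κ log n), and a refined form of the same
identity gives a_n ~ 1/(κ n log² n) (`tendsto_recip_log`). For Φ = 1 everything is algebraic: exp g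
is the square of the rescaled Catalan series.

If q continued analytically to 1/C_N, non-negativity of the coefficients would force ∑ n^j e_n < ∞
for every j (`summable_of_analyticAt`), against the polynomial size of e_n. The singularity in turn
fixes the radius of convergence. -/

noncomputable section

namespace CanonicalCoordinate

/-! ### Convolutions against slowly varying weights -/

/-- Positive sequences that vary slowly enough for the two halves of a convolution to be compared
with a single value. -/
structure IsTempered (v : ℕ → ℝ) : Prop where
  pos : ∀ n, 0 < v n
  ratio : Tendsto (fun n => v (n + 1) / v n) atTop (𝓝 1)
  doubling : ∃ K, 0 ≤ K ∧ ∀ n j, n ≤ 2 * j → j ≤ n → v j ≤ K * v n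

/-- `x` is bounded by a multiple of `w`. -/
def DominatedBy (x w : ℕ → ℝ) : Prop := ∃ M, 0 ≤ M ∧ ∀ n, |x n| ≤ M * w n

lemma IsTempered.tendsto_shift {v : ℕ → ℝ} (hv : IsTempered v) (j : ℕ) :
    Tendsto (fun n => v (n - j) / v n) atTop (𝓝 1) := by
  have h : Tendsto (fun n => v n / v (n + j)) atTop (𝓝 1) := by
    induction j with
    | zero =>
      refine tendsto_const_nhds.congr fun n => ?_
      simp [(hv.pos n).ne']
    | succ j ih =>
      have h1 := (hv.ratio.comp (tendsto_add_atTop_nat j)).inv₀ one_ne_zero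
      have h2 := ih.mul h1
      simp only [inv_one, mul_one] at h2
      refine h2.congr fun n => ?_
      have := (hv.pos (n + j)).ne'
      have := (hv.pos (n + j + 1)).ne'
      simp only [Function.comp, ← add_assoc]
      field_simp
  have h3 := h.comp (tendsto_sub_atTop_nat j)
  refine h3.congr' ?_
  filter_upwards [eventually_ge_atTop j] with n hn
  simp [Nat.sub_add_cancel hn]

lemma dominatedBy_of_tendsto {x w : ℕ → ℝ} {α : ℝ} (hw : ∀ n, 0 < w n)
    (h : Tendsto (fun n => x n / w n) atTop (𝓝 α)) : DominatedBy x w := by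
  obtain ⟨M, hM⟩ := h.abs.bddAbove_range
  have hM' : ∀ n, |x n| ≤ M * w n := by
    intro n
    have := hM ⟨n, rfl⟩
    simp only [abs_div, abs_of_pos (hw n)] at this
    rwa [div_le_iff₀ (hw n)] at this
  refine ⟨M, ?_, hM'⟩
  have h0 := (abs_nonneg _).trans (hM' 0)
  exact nonneg_of_mul_nonneg_left h0 (hw 0)

lemma DominatedBy.summable {x w : ℕ → ℝ} (h : DominatedBy x w) (hw : Summable w) :
    Summable (fun n => |x n|) := by
  obtain ⟨M, -, hM⟩ := h
  exact Summable.of_nonneg_of_le (fun n => abs_nonneg _) hM (hw.mul_left M)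

/-- Cutting at the middle leaves in each half a small index `j` with `2 * j ≤ n`, so that `n - j`
lies in the range where the doubling bound compares `w (n - j)` with `w n`. -/
lemma sum_antidiagonal_split (x y : ℕ → ℝ) (n : ℕ) :
    ∑ p ∈ Finset.HasAntidiagonal.antidiagonal n, x p.1 * y p.2 =
      ∑ j ∈ Finset.range (n / 2 + 1), x j * y (n - j) +
        ∑ j ∈ Finset.range ((n + 1) / 2), y j * x (n - j) := by
  rw [Finset.Nat.sum_antidiagonal_eq_sum_range_succ (fun i j => x i * y j)]
  have h : n.succ = n / 2 + 1 + (n + 1) / 2 := by omega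
  rw [h, Finset.sum_range_add]
  congr 1
  rw [← Finset.sum_range_reflect]
  refine Finset.sum_congr rfl fun j hj => ?_
  rw [Finset.mem_range] at hj
  have h1 : n / 2 + 1 + ((n + 1) / 2 - 1 - j) = n - j := by omega
  have h2 : n - (n - j) = j := by omega
  rw [h1, h2, mul_comm]

/-- Tannery's theorem: for fixed `j` the term tends to `x j * β`, and doubling supplies the summable
majorant `|x j| * (M * K)`. -/
lemma tendsto_half_convolution {v x y : ℕ → ℝ} {β : ℝ} (hv : IsTempered v)
    (hx : Summable (fun n => |x n|)) (hy : Tendsto (fun n => y n / v n) atTop (𝓝 β))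
    {r : ℕ → ℕ} (hr : Tendsto r atTop atTop) (hr' : ∀ n j, j < r n → 2 * j ≤ n) :
    Tendsto (fun n => (∑ j ∈ Finset.range (r n), x j * y (n - j)) / v n) atTop
      (𝓝 (β * ∑' j, x j)) := by
  obtain ⟨M, hM0, hM⟩ := dominatedBy_of_tendsto hv.pos hy
  obtain ⟨K, hK0, hK⟩ := hv.doubling
  have key : Tendsto (fun n => ∑' j, if j < r n then x j * y (n - j) / v n else 0) atTop
      (𝓝 (∑' j, x j * β)) := by
    refine tendsto_tsum_of_dominated_convergence (bound := fun j => |x j| * (M * K))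
      (hx.mul_right _) ?_ ?_
    · intro j
      have h1 : Tendsto (fun n => y (n - j) / v (n - j)) atTop (𝓝 β) :=
        hy.comp (tendsto_sub_atTop_nat j)
      have h2 := (h1.mul (hv.tendsto_shift j)).const_mul (x j)
      rw [mul_one] at h2
      refine h2.congr' ?_
      filter_upwards [hr.eventually_gt_atTop j] with n hn
      rw [if_pos hn]
      have := (hv.pos (n - j)).ne'
      have := (hv.pos n).ne'
      field_simp
    · refine Eventually.of_forall fun n j => ?_
      split_ifs with h
      · have h2 := hr' n j h
        rw [Real.norm_eq_abs, abs_div, abs_mul, abs_of_pos (hv.pos n), mul_div_assoc]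
        refine mul_le_mul_of_nonneg_left ?_ (abs_nonneg _)
        rw [div_le_iff₀ (hv.pos n), mul_assoc]
        exact (hM _).trans (mul_le_mul_of_nonneg_left (hK _ _ (by omega) (by omega)) hM0)
      · simp only [norm_zero]; positivity
  rw [tsum_mul_right, mul_comm] at key
  refine key.congr fun n => ?_
  rw [tsum_eq_sum (s := Finset.range (r n)) (fun j hj => by
    rw [if_neg]; simpa using hj), Finset.sum_div]
  exact Finset.sum_congr rfl fun j hj => if_pos (Finset.mem_range.mp hj)

lemma abs_half_convolution_le {w x y : ℕ → ℝ} {K M S : ℝ}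
    (hK : ∀ n j, n ≤ 2 * j → j ≤ n → w j ≤ K * w n) (hM0 : 0 ≤ M) (hM : ∀ n, |y n| ≤ M * w n)
    {n r : ℕ} (hr : ∀ j < r, 2 * j ≤ n) (hS : ∑ j ∈ Finset.range r, |x j| ≤ S) (hw : 0 ≤ K * w n) :
    |∑ j ∈ Finset.range r, x j * y (n - j)| ≤ S * (M * (K * w n)) := by
  refine (Finset.abs_sum_le_sum_abs _ _).trans ?_
  calc ∑ j ∈ Finset.range r, |x j * y (n - j)|
      ≤ ∑ j ∈ Finset.range r, |x j| * (M * (K * w n)) := by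
        refine Finset.sum_le_sum fun j hj => ?_
        have h2 := hr j (Finset.mem_range.mp hj)
        rw [abs_mul]
        refine mul_le_mul_of_nonneg_left ?_ (abs_nonneg _)
        exact (hM _).trans (mul_le_mul_of_nonneg_left (hK _ _ (by omega) (by omega)) hM0)
    _ ≤ S * (M * (K * w n)) := by
        rw [← Finset.sum_mul]
        exact mul_le_mul_of_nonneg_right hS (mul_nonneg hM0 hw)

lemma tendsto_half_add_one : Tendsto (fun n : ℕ => n / 2 + 1) atTop atTop :=
  tendsto_atTop.2 fun b => (eventually_ge_atTop (2 * b)).mono fun n hn => by omega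

lemma tendsto_add_one_half : Tendsto (fun n : ℕ => (n + 1) / 2) atTop atTop :=
  tendsto_atTop.2 fun b => (eventually_ge_atTop (2 * b)).mono fun n hn => by omega

lemma tendsto_convolution {w x y : ℕ → ℝ} {α β : ℝ} (hw : IsTempered w) (hws : Summable w)
    (hx : Tendsto (fun n => x n / w n) atTop (𝓝 α))
    (hy : Tendsto (fun n => y n / w n) atTop (𝓝 β)) :
    Tendsto (fun n => (∑ p ∈ Finset.HasAntidiagonal.antidiagonal n, x p.1 * y p.2) / w n) atTop
      (𝓝 (β * ∑' j, x j + α * ∑' j, y j)) := by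
  have hxs := (dominatedBy_of_tendsto hw.pos hx).summable hws
  have hys := (dominatedBy_of_tendsto hw.pos hy).summable hws
  have h1 := tendsto_half_convolution hw hxs hy tendsto_half_add_one (fun n j h => by omega)
  have h2 := tendsto_half_convolution hw hys hx tendsto_add_one_half (fun n j h => by omega)
  refine (h1.add h2).congr fun n => ?_
  rw [sum_antidiagonal_split, add_div]

lemma DominatedBy.convolution {w x y : ℕ → ℝ} (hw : IsTempered w) (hws : Summable w)
    (hx : DominatedBy x w) (hy : DominatedBy y w) :
    DominatedBy (fun n => ∑ p ∈ Finset.HasAntidiagonal.antidiagonal n, x p.1 * y p.2) w := by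
  have hxs := hx.summable hws
  have hys := hy.summable hws
  obtain ⟨M, hM0, hM⟩ := hx
  obtain ⟨M', hM0', hM'⟩ := hy
  obtain ⟨K, hK0, hK⟩ := hw.doubling
  refine ⟨(∑' j, |x j|) * (M' * K) + (∑' j, |y j|) * (M * K), by positivity, fun n => ?_⟩
  have hn : 0 ≤ K * w n := mul_nonneg hK0 (hw.pos n).le
  have h1 := abs_half_convolution_le (x := x) (n := n) (r := n / 2 + 1) hK hM0' hM'
    (fun j h => by omega) (hxs.sum_le_tsum _ fun _ _ => abs_nonneg _) hn
  have h2 := abs_half_convolution_le (x := y) (n := n) (r := (n + 1) / 2) hK hM0 hM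
    (fun j h => by omega) (hys.sum_le_tsum _ fun _ _ => abs_nonneg _) hn
  simp only [sum_antidiagonal_split]
  refine (abs_add_le _ _).trans ((add_le_add h1 h2).trans (le_of_eq ?_))
  ring

lemma tendsto_cesaro_zero {u : ℕ → ℝ} (hu : Tendsto u atTop (𝓝 0)) :
    Tendsto (fun n : ℕ => (∑ j ∈ Finset.range (n + 1), |u j|) / ((n : ℝ) + 1)) atTop (𝓝 0) := by
  have h := (hu.abs.cesaro).comp (tendsto_add_atTop_nat 1)
  simp only [abs_zero] at h
  refine h.congr fun n => ?_
  simp only [Function.comp, Nat.cast_add, Nat.cast_one]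
  rw [mul_comm, div_eq_mul_inv]

lemma IsTempered.succ_mul {w : ℕ → ℝ} (hw : IsTempered w) :
    IsTempered (fun n => ((n : ℝ) + 1) * w n) where
  pos n := mul_pos (by positivity) (hw.pos n)
  ratio := by
    have h1 : Tendsto (fun n : ℕ => 1 + 1 / ((n : ℝ) + 1)) atTop (𝓝 (1 + 0)) :=
      tendsto_const_nhds.add tendsto_one_div_add_atTop_nhds_zero_nat
    have h2 := h1.mul hw.ratio
    rw [add_zero, one_mul] at h2
    refine h2.congr fun n => ?_
    have := (hw.pos n).ne'
    push_cast
    field_simp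
  doubling := by
    obtain ⟨K, hK0, hK⟩ := hw.doubling
    refine ⟨K, hK0, fun n j h1 h2 => ?_⟩
    have h3 : (j : ℝ) + 1 ≤ n + 1 := by gcongr
    calc ((j : ℝ) + 1) * w j ≤ (n + 1) * (K * w n) :=
          mul_le_mul h3 (hK n j h1 h2) (hw.pos j).le (by positivity)
      _ = _ := by ring

/-- A convolution in which the first factor decays faster than the weight. -/
lemma tendsto_convolution_of_quadratic_decay {v p y : ℕ → ℝ} {β M : ℝ} (hv : IsTempered v)
    (hp : ∀ n : ℕ, |p n| ≤ M / ((n : ℝ) + 1) ^ 2)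
    (hv0 : Tendsto v atTop (𝓝 0)) (hvn : Tendsto (fun n : ℕ => ((n : ℝ) + 1) * v n) atTop atTop)
    (hy : Tendsto (fun n => y n / v n) atTop (𝓝 β)) :
    Tendsto (fun n => (∑ q ∈ Finset.HasAntidiagonal.antidiagonal n, p q.1 * y q.2) / v n) atTop
      (𝓝 (β * ∑' j, p j)) := by
  have hM0 : 0 ≤ M := by simpa using (abs_nonneg _).trans (hp 0)
  have hps : Summable (fun n => |p n|) := by
    have h : Summable (fun n : ℕ => 1 / ((n : ℝ) + 1) ^ 2) := by
      have := (summable_nat_add_iff (f := fun n : ℕ => 1 / (n : ℝ) ^ 2) 1).2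
        (Real.summable_one_div_nat_pow.2 one_lt_two)
      simpa using this
    refine Summable.of_nonneg_of_le (fun n => abs_nonneg _) (fun n => ?_) (h.mul_left M)
    simpa [div_eq_mul_inv] using hp n
  have hy0 : Tendsto y atTop (𝓝 0) := by
    have := hy.mul hv0
    rw [mul_zero] at this
    exact this.congr fun n => div_mul_cancel₀ _ (hv.pos n).ne'
  have h1 := tendsto_half_convolution hv hps hy tendsto_half_add_one (fun n j h => by omega)
  -- Here the index of `p` is at least n/2, so `p` is at most 4M/(n+1)²; after division by `v n`
  -- this half is at most 4M times the Cesàro mean of |y| times 1/((n+1) v n), and both factors tend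
  -- to 0.
  have h2 : Tendsto (fun n => (∑ j ∈ Finset.range ((n + 1) / 2), y j * p (n - j)) / v n) atTop
      (𝓝 0) := by
    have h3 := ((tendsto_cesaro_zero hy0).mul hvn.inv_tendsto_atTop).const_mul (4 * M)
    simp only [mul_zero] at h3
    refine squeeze_zero_norm (fun n => ?_) h3
    have hvp := hv.pos n
    have h4 := abs_half_convolution_le (w := fun n : ℕ => 1 / ((n : ℝ) + 1) ^ 2) (K := 4) (x := y)
      (y := p) (n := n) (r := (n + 1) / 2) (S := ∑ j ∈ Finset.range (n + 1), |y j|) (M := M)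
      (fun n j h1 h2 => by
        have h1' : (n : ℝ) ≤ 2 * j := by exact_mod_cast h1
        rw [mul_one_div, div_le_div_iff₀ (by positivity) (by positivity)]
        nlinarith [Nat.cast_nonneg (α := ℝ) n])
      hM0 (fun n => by simpa [div_eq_mul_inv] using hp n) (fun j h => by omega)
      (Finset.sum_le_sum_of_subset_of_nonneg (Finset.range_subset_range.2 (by omega))
        fun _ _ _ => abs_nonneg _) (by positivity)
    rw [Real.norm_eq_abs, abs_div, abs_of_pos hvp, div_le_iff₀ hvp]
    refine h4.trans (le_of_eq ?_)
    simp only [Pi.inv_apply]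
    field_simp
  have h3 := h1.add h2
  rw [add_zero] at h3
  refine h3.congr fun n => ?_
  rw [sum_antidiagonal_split, add_div]

/-- If `z' = x' y` for the generating functions and `y` is bounded by the weight, then `z` inherits
the asymptotics of `x`. -/
lemma tendsto_of_derivative_eq {w x y z : ℕ → ℝ} {α : ℝ} (hw : IsTempered w) (hws : Summable w)
    (hw0 : Tendsto (fun n : ℕ => ((n : ℝ) + 1) * w n) atTop (𝓝 0))
    (hx : Tendsto (fun n => x n / w n) atTop (𝓝 α)) (hy : DominatedBy y w)
    (h : ∀ n : ℕ, (n : ℝ) * z n =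
      ∑ p ∈ Finset.HasAntidiagonal.antidiagonal n, (p.1 * x p.1) * y p.2) :
    Tendsto (fun n => z n / w n) atTop (𝓝 (α * ∑' j, y j)) := by
  have hys := hy.summable hws
  have hn : Tendsto (fun n : ℕ => (n : ℝ) / ((n : ℝ) + 1)) atTop (𝓝 1) :=
    tendsto_natCast_div_add_atTop 1
  have hx' : Tendsto (fun n : ℕ => ((n : ℝ) * x n) / (((n : ℝ) + 1) * w n)) atTop (𝓝 α) := by
    have := hn.mul hx
    rw [one_mul] at this
    refine this.congr fun n => ?_
    rw [div_mul_div_comm]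
  have hx0 : Tendsto (fun n : ℕ => (n : ℝ) * x n) atTop (𝓝 0) := by
    have := hx'.mul hw0
    rw [mul_zero] at this
    exact this.congr fun n => div_mul_cancel₀ _ (hw.succ_mul.pos n).ne'
  have h1 := tendsto_half_convolution hw.succ_mul hys hx' tendsto_add_one_half
    (fun n j h => by omega)
  -- This half is negligible: `y (n - j)` is `O(w n)`, and dividing by `(n + 1) * w n` leaves a
  -- Cesàro mean of `j * x j`, which tends to 0.
  have h2 : Tendsto (fun n : ℕ => (∑ j ∈ Finset.range (n / 2 + 1), ((j : ℝ) * x j) * y (n - j)) /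
      (((n : ℝ) + 1) * w n)) atTop (𝓝 0) := by
    obtain ⟨M, hM0, hM⟩ := hy
    obtain ⟨K, hK0, hK⟩ := hw.doubling
    have h3 := (tendsto_cesaro_zero hx0).const_mul (M * K)
    rw [mul_zero] at h3
    refine squeeze_zero_norm (fun n => ?_) h3
    have hwp := hw.pos n
    have h4 := abs_half_convolution_le (x := fun j : ℕ => (j : ℝ) * x j) (n := n) (r := n / 2 + 1)
      (S := ∑ j ∈ Finset.range (n + 1), |(j : ℝ) * x j|) hK hM0 hM (fun j h => by omega)
      (Finset.sum_le_sum_of_subset_of_nonneg (Finset.range_subset_range.2 (by omega))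
        fun _ _ _ => abs_nonneg _) (mul_nonneg hK0 hwp.le)
    have hvp : 0 < ((n : ℝ) + 1) * w n := by positivity
    rw [Real.norm_eq_abs, abs_div, abs_of_pos hvp, div_le_iff₀ hvp]
    refine h4.trans (le_of_eq ?_)
    field_simp
  have h3 := (h2.add h1).div hn one_ne_zero
  rw [zero_add, div_one] at h3
  refine h3.congr' ?_
  filter_upwards [eventually_gt_atTop 0] with n hn0
  have hwp := hw.pos n
  have hn0' : (n : ℝ) ≠ 0 := by exact_mod_cast hn0.ne'
  have := h n
  rw [sum_antidiagonal_split (fun j : ℕ => (j : ℝ) * x j)] at this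
  simp only [Pi.div_apply]
  rw [← add_div, ← this]
  field_simp

/-- Strong induction on n |e_n| ≤ n R w_n. The half with small index on `e` is controlled by the
summability of `e`; the other half uses the induction hypothesis, multiplied by a Cesàro mean of `j
* g j` that is small for large n. -/
lemma dominatedBy_of_log_derivative {w g e : ℕ → ℝ} (hw : IsTempered w)
    (hw0 : Tendsto (fun n : ℕ => ((n : ℝ) + 1) * w n) atTop (𝓝 0))
    (hg : DominatedBy g w) (he : Summable (fun n => |e n|))
    (h : ∀ n : ℕ, (n : ℝ) * e n =
      ∑ p ∈ Finset.HasAntidiagonal.antidiagonal n, (p.1 * g p.1) * e p.2) :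
    DominatedBy e w := by
  obtain ⟨M, hM0, hM⟩ := hg
  obtain ⟨K, hK0, hK⟩ := hw.doubling
  set S := ∑' j, |e j|
  have hS0 : 0 ≤ S := tsum_nonneg fun _ => abs_nonneg _
  have hg0 : Tendsto (fun n : ℕ => (n : ℝ) * g n) atTop (𝓝 0) := by
    have h3 := hw0.const_mul M
    rw [mul_zero] at h3
    refine squeeze_zero_norm (fun n => ?_) h3
    rw [Real.norm_eq_abs, abs_mul, Nat.abs_cast]
    have := mul_le_mul (by linarith : (n : ℝ) ≤ n + 1) (hM n) (abs_nonneg _) (by positivity)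
    linarith
  -- Beyond `n₀` the half using the induction hypothesis costs at most 1/2 of the target, as n + 1 ≤
  -- 2n.
  obtain ⟨n₀, hn₀⟩ := eventually_atTop.1
    ((((tendsto_cesaro_zero hg0).const_mul (4 * K)).eventually_le_const
      (u := 1) (by simp)).and (eventually_ge_atTop 1))
  have hfin : ∃ Q : ℝ, 0 ≤ Q ∧ ∀ n < n₀, |e n| ≤ Q * w n := by
    refine ⟨∑ n ∈ Finset.range n₀, |e n| / w n,
      Finset.sum_nonneg fun n _ => div_nonneg (abs_nonneg _) (hw.pos n).le, fun n hn => ?_⟩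
    rw [← div_le_iff₀ (hw.pos n)]
    exact Finset.single_le_sum (f := fun n => |e n| / w n)
      (fun n _ => div_nonneg (abs_nonneg _) (hw.pos n).le) (Finset.mem_range.2 hn)
  obtain ⟨Q, hQ0, hQ⟩ := hfin
  -- `Q` covers the indices below `n₀`; the second summand makes the half bounded by `S` cost at
  -- most 1/4 of the target.
  set R := Q + 4 * (M * (K * S)) with hR
  have hR0 : 0 ≤ R := by positivity
  refine ⟨R, hR0, fun n => ?_⟩
  induction n using Nat.strong_induction_on with
  | _ n ih =>
    have hwp := hw.pos n
    rcases lt_or_ge n n₀ with hn | hn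
    · refine (hQ n hn).trans (mul_le_mul_of_nonneg_right ?_ hwp.le)
      have : 0 ≤ M * (K * S) := by positivity
      linarith
    obtain ⟨hc, hn1⟩ := hn₀ n hn
    have hn1' : (1 : ℝ) ≤ n := by exact_mod_cast hn1
    have h1 : |∑ j ∈ Finset.range ((n + 1) / 2), e j * (((n - j : ℕ) : ℝ) * g (n - j))| ≤
        S * (M * (K * (n * w n))) := by
      refine (Finset.abs_sum_le_sum_abs _ _).trans ?_
      calc _ ≤ ∑ j ∈ Finset.range ((n + 1) / 2), |e j| * (M * (K * (n * w n))) := by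
            refine Finset.sum_le_sum fun j hj => ?_
            rw [Finset.mem_range] at hj
            rw [abs_mul, abs_mul, Nat.abs_cast]
            refine mul_le_mul_of_nonneg_left ?_ (abs_nonneg _)
            have h5 : ((n - j : ℕ) : ℝ) ≤ n := by exact_mod_cast Nat.sub_le _ _
            have h6 : |g (n - j)| ≤ M * (K * w n) := (hM _).trans
              (mul_le_mul_of_nonneg_left (hK _ _ (by omega) (by omega)) hM0)
            calc _ ≤ (n : ℝ) * (M * (K * w n)) :=
                  mul_le_mul h5 h6 (abs_nonneg _) (by positivity)
              _ = _ := by ring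
        _ ≤ _ := by
            rw [← Finset.sum_mul]
            exact mul_le_mul_of_nonneg_right (he.sum_le_tsum _ fun _ _ => abs_nonneg _)
              (by positivity)
    have h2 : |∑ j ∈ Finset.range (n / 2 + 1), ((j : ℝ) * g j) * e (n - j)| ≤
        (∑ j ∈ Finset.range (n + 1), |(j : ℝ) * g j|) * (R * (K * w n)) := by
      refine (Finset.abs_sum_le_sum_abs _ _).trans ?_
      calc _ ≤ ∑ j ∈ Finset.range (n / 2 + 1), |(j : ℝ) * g j| * (R * (K * w n)) := by
            refine Finset.sum_le_sum fun j hj => ?_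
            rw [Finset.mem_range] at hj
            rw [abs_mul]
            rcases Nat.eq_zero_or_pos j with rfl | hj0
            · simp
            · refine mul_le_mul_of_nonneg_left ?_ (abs_nonneg _)
              exact (ih _ (by omega)).trans
                (mul_le_mul_of_nonneg_left (hK _ _ (by omega) (by omega)) hR0)
        _ ≤ _ := by
            rw [← Finset.sum_mul]
            exact mul_le_mul_of_nonneg_right
              (Finset.sum_le_sum_of_subset_of_nonneg (Finset.range_subset_range.2 (by omega))
                fun _ _ _ => abs_nonneg _) (by positivity)
    rw [← mul_div_assoc, div_le_one (by positivity)] at hc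
    have h3 := h n
    rw [sum_antidiagonal_split (fun j : ℕ => (j : ℝ) * g j)] at h3
    have h4 : (n : ℝ) * |e n| ≤ (n : ℝ) * (R * w n) := by
      rw [← Nat.abs_cast n, ← abs_mul, h3, Nat.abs_cast]
      refine (abs_add_le _ _).trans ((add_le_add h2 h1).trans ?_)
      have h7 : (∑ j ∈ Finset.range (n + 1), |(j : ℝ) * g j|) * (R * (K * w n)) ≤
          n * (R * w n) / 2 := by
        have := mul_le_mul_of_nonneg_right hc (by positivity : 0 ≤ R * w n)
        have h8 : ((n : ℝ) + 1) * (R * w n) ≤ (2 * n) * (R * w n) :=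
          mul_le_mul_of_nonneg_right (by linarith) (by positivity)
        linarith
      have h8 : S * (M * (K * (n * w n))) ≤ n * (R * w n) / 4 := by
        rw [hR]
        have : 0 ≤ n * (Q * w n) := by positivity
        linarith
      have : 0 ≤ n * (R * w n) := by positivity
      linarith
    exact le_of_mul_le_mul_left h4 (by linarith)

/-! ### Kaluza's theorem and positivity of the quotient -/

/-- The sequence `a` with `1 / ∑ bₙ zⁿ = 1 - ∑ aₙ zⁿ`. -/
def recipSeq (b : ℕ → ℝ) (n : ℕ) : ℝ := PowerSeries.coeff n (1 - (PowerSeries.mk b)⁻¹)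

/-- The coefficients of the quotient of `∑ hₙ bₙ zⁿ` by `∑ bₙ zⁿ`. -/
def quotSeq (b h : ℕ → ℝ) (n : ℕ) : ℝ :=
  PowerSeries.coeff n (PowerSeries.mk (fun n => h n * b n) * (PowerSeries.mk b)⁻¹)

/-- The properties shared by the normalised coefficients `b` and the harmonic factors `h`. -/
structure IsKaluzaPair (b h : ℕ → ℝ) (L : ℝ) : Prop where
  zero : b 0 = 1
  pos : ∀ n, 0 < b n
  anti : ∀ n, b (n + 1) ≤ b n
  logConvex : ∀ n, b (n + 1) / b n ≤ b (n + 2) / b (n + 1)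
  h_zero : h 0 = 0
  h_mono : StrictMono h
  h_lim : Tendsto h atTop (𝓝 L)

section recip

variable {b h : ℕ → ℝ} {L : ℝ}

lemma mk_recipSeq (b : ℕ → ℝ) : PowerSeries.mk (recipSeq b) = 1 - (PowerSeries.mk b)⁻¹ := by
  ext n; simp [recipSeq]

lemma mk_mul_one_sub_recipSeq (hb : b 0 = 1) :
    PowerSeries.mk b * (1 - PowerSeries.mk (recipSeq b)) = 1 := by
  rw [mk_recipSeq, sub_sub_cancel]
  exact PowerSeries.mul_inv_cancel _ (by simp [hb])

lemma recipSeq_zero (hb : b 0 = 1) : recipSeq b 0 = 0 := by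
  simp [recipSeq, hb]

lemma convolution_recipSeq (hb : b 0 = 1) (n : ℕ) :
    ∑ p ∈ Finset.HasAntidiagonal.antidiagonal (n + 1), recipSeq b p.1 * b p.2 = b (n + 1) := by
  have h := congrArg (PowerSeries.coeff (n + 1)) (mk_mul_one_sub_recipSeq hb)
  rw [mul_sub, mul_one, mul_comm, map_sub, PowerSeries.coeff_mul] at h
  simp [PowerSeries.coeff_one] at h
  linarith

lemma sum_range_recipSeq (hb : b 0 = 1) (n : ℕ) :
    ∑ k ∈ Finset.range (n + 1), recipSeq b (k + 1) * b (n - k) = b (n + 1) := by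
  rw [← convolution_recipSeq hb n,
    Finset.Nat.sum_antidiagonal_eq_sum_range_succ (fun i j => recipSeq b i * b j),
    Finset.sum_range_succ' _ (n + 1)]
  simp [recipSeq_zero hb]

lemma mk_quotSeq (b h : ℕ → ℝ) :
    PowerSeries.mk (quotSeq b h) =
      PowerSeries.mk (fun n => h n * b n) * (1 - PowerSeries.mk (recipSeq b)) := by
  rw [mk_recipSeq, sub_sub_cancel]
  ext n; simp [quotSeq]

namespace IsKaluzaPair

lemma antitone (hK : IsKaluzaPair b h L) : Antitone b := antitone_nat_of_succ_le hK.anti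

lemma le_one (hK : IsKaluzaPair b h L) (n : ℕ) : b n ≤ 1 := hK.zero ▸ hK.antitone (Nat.zero_le n)

lemma ratio_le (hK : IsKaluzaPair b h L) {i n : ℕ} (hin : i ≤ n) :
    b (i + 1) / b i ≤ b (n + 1) / b n :=
  monotone_nat_of_le_succ (f := fun n => b (n + 1) / b n) hK.logConvex hin

/-- Kaluza's argument. Log-convexity gives b_{n+1-k} ≤ b_{n-k} b_{n+2}/b_{n+1}; inserting this in
the recurrence for b_{n+2} and using that for b_{n+1}, all terms except a_{n+2} add up to at most
b_{n+2}. -/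
lemma recip_nonneg (hK : IsKaluzaPair b h L) (n : ℕ) : 0 ≤ recipSeq b n := by
  induction n using Nat.strong_induction_on with
  | _ n ih =>
    rcases n with _ | n
    · rw [recipSeq_zero hK.zero]
    rcases n with _ | n
    · have := sum_range_recipSeq hK.zero 0
      simp [hK.zero] at this
      rw [zero_add, this]
      exact (hK.pos 1).le
    have h1 := sum_range_recipSeq hK.zero (n + 1)
    have h2 := sum_range_recipSeq hK.zero n
    rw [Finset.sum_range_succ] at h1
    have h3 : ∑ k ∈ Finset.range (n + 1), recipSeq b (k + 1) * b (n + 1 - k) ≤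
        ∑ k ∈ Finset.range (n + 1), recipSeq b (k + 1) * b (n - k) * (b (n + 2) / b (n + 1)) := by
      refine Finset.sum_le_sum fun k hk => ?_
      have hk' := Finset.mem_range.1 hk
      rw [mul_assoc]
      refine mul_le_mul_of_nonneg_left ?_ (ih _ (by omega))
      have h4 := hK.ratio_le (i := n - k) (n := n + 1) (by omega)
      rw [div_le_iff₀ (hK.pos _)] at h4
      have h5 : n + 1 - k = n - k + 1 := by omega
      rw [h5, mul_comm]
      exact h4
    rw [← Finset.sum_mul, h2, mul_div_cancel₀ _ (hK.pos _).ne'] at h3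
    simp only [Nat.sub_self, hK.zero, mul_one] at h1
    have h6 : n + 1 + 1 = n + 2 := rfl
    rw [h6] at h1 ⊢
    linarith

lemma recip_le (hK : IsKaluzaPair b h L) (n : ℕ) : recipSeq b n ≤ b n := by
  rcases n with _ | n
  · rw [recipSeq_zero hK.zero]; exact (hK.pos 0).le
  rw [← sum_range_recipSeq hK.zero n]
  have := Finset.single_le_sum (f := fun k => recipSeq b (k + 1) * b (n - k))
    (s := Finset.range (n + 1))
    (fun k _ => mul_nonneg (hK.recip_nonneg _) (hK.pos _).le) (Finset.self_mem_range_succ n)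
  simpa [hK.zero] using this

/-- In b_{n+1} = ∑ a_{k+1} b_{n-k} every b_{n-k} is at least b_{n+1}, which can then be cancelled.
-/
lemma sum_recip_le_one (hK : IsKaluzaPair b h L) (n : ℕ) :
    ∑ k ∈ Finset.range n, recipSeq b k ≤ 1 := by
  rcases n with _ | n
  · simp
  rw [Finset.sum_range_succ', recipSeq_zero hK.zero, add_zero]
  rcases n with _ | n
  · simp
  have h1 := sum_range_recipSeq hK.zero n
  have h2 : ∑ k ∈ Finset.range (n + 1), recipSeq b (k + 1) * b (n + 1) ≤ b (n + 1) := by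
    refine (Finset.sum_le_sum fun k _ => ?_).trans h1.le
    exact mul_le_mul_of_nonneg_left (hK.antitone (by omega)) (hK.recip_nonneg _)
  rw [← Finset.sum_mul] at h2
  exact le_of_mul_le_mul_right (by simpa using h2) (hK.pos (n + 1))

lemma summable_recip (hK : IsKaluzaPair b h L) : Summable (recipSeq b) :=
  summable_of_sum_range_le hK.recip_nonneg hK.sum_recip_le_one

lemma h_le (hK : IsKaluzaPair b h L) (n : ℕ) : h n ≤ L :=
  hK.h_mono.monotone.ge_of_tendsto hK.h_lim n

lemma h_lt (hK : IsKaluzaPair b h L) (n : ℕ) : h n < L :=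
  (hK.h_mono n.lt_succ_self).trans_le (hK.h_le _)

lemma h_nonneg (hK : IsKaluzaPair b h L) (n : ℕ) : 0 ≤ h n :=
  hK.h_zero ▸ hK.h_mono.monotone n.zero_le

/-- Replacing `h` by `L - h` makes the first factor small compared with the weight, so that only the
second one contributes to the asymptotics of the product. -/
lemma mk_quotSeq_eq_sub (hK : IsKaluzaPair b h L) :
    PowerSeries.mk (quotSeq b h) = PowerSeries.C L -
      PowerSeries.mk (fun n => (L - h n) * b n) * (1 - PowerSeries.mk (recipSeq b)) := by
  have h1 : PowerSeries.mk (fun n => (L - h n) * b n) =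
      PowerSeries.C L * PowerSeries.mk b - PowerSeries.mk (fun n => h n * b n) := by
    ext n; simp [sub_mul]
  rw [h1, mk_quotSeq]
  linear_combination PowerSeries.C L * mk_mul_one_sub_recipSeq hK.zero

lemma quot_zero (hK : IsKaluzaPair b h L) : quotSeq b h 0 = 0 := by
  simp [quotSeq, hK.h_zero]

lemma quot_nonneg (hK : IsKaluzaPair b h L) (n : ℕ) : 0 ≤ quotSeq b h n := by
  rcases n with _ | n
  · rw [hK.quot_zero]
  have h1 := congrArg (PowerSeries.coeff (n + 1)) (mk_quotSeq b h)
  rw [mul_sub, mul_one, mul_comm, map_sub, PowerSeries.coeff_mul] at h1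
  simp only [PowerSeries.coeff_mk] at h1
  -- Expanding b_{n+1} as a convolution with a turns the coefficient into ∑ a_k b_j (h_{n+1} - h_j),
  -- where h is increasing.
  rw [h1, ← convolution_recipSeq hK.zero, Finset.mul_sum, ← Finset.sum_sub_distrib]
  refine Finset.sum_nonneg fun p hp => ?_
  have h2 : h p.2 ≤ h (n + 1) := hK.h_mono.monotone (by
    have := Finset.HasAntidiagonal.mem_antidiagonal.1 hp; omega)
  have := mul_nonneg (sub_nonneg.2 h2) (mul_nonneg (hK.recip_nonneg p.1) (hK.pos p.2).le)
  linarith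

end IsKaluzaPair

end recip

/-! ### Power series on a disk: products, quotients, exponentials -/

/-- `f` is the sum of the power series with coefficients `a` on the disk of radius `R`. -/
def IsSumOn (a : ℕ → ℂ) (f : ℂ → ℂ) (R : ℝ) : Prop :=
  ∀ z : ℂ, ‖z‖ < R → HasSum (fun n => a n * z ^ n) (f z)

namespace IsSumOn

variable {a c : ℕ → ℂ} {f g : ℂ → ℂ} {R : ℝ}

lemma summable_norm (h : IsSumOn a f R) {z : ℂ} (hz : ‖z‖ < R) :
    Summable (fun n => ‖a n * z ^ n‖) := (h z hz).summable.norm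

lemma hasFPowerSeriesOnBall (h : IsSumOn a f R) (hR : 0 < R) :
    HasFPowerSeriesOnBall f (FormalMultilinearSeries.ofScalars ℂ a) 0 (ENNReal.ofReal R) where
  r_le := by
    refine ENNReal.le_of_forall_nnreal_lt fun r hr => ?_
    have hr' : (r : ℝ) < R := by
      rwa [ENNReal.ofReal, ENNReal.coe_lt_coe, Real.lt_toNNReal_iff_coe_lt] at hr
    refine FormalMultilinearSeries.le_radius_of_tendsto _ (l := 0) ?_
    have h1 := (h.summable_norm (z := (r : ℂ)) (by simpa using hr')).tendsto_atTop_zero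
    refine h1.congr fun n => ?_
    simp
  r_pos := by simpa using hR
  hasSum := by
    intro y hy
    rw [Metric.eball_ofReal, Metric.mem_ball, dist_zero_right] at hy
    rw [zero_add]
    refine (h y hy).congr_fun ?_
    intro n
    simp [mul_comm]

lemma iteratedDeriv_eq (h : IsSumOn a f R) (hR : 0 < R) (n : ℕ) :
    iteratedDeriv n f 0 = n.factorial * a n := by
  have h1 := (h.hasFPowerSeriesOnBall hR).factorial_smul (1 : ℂ) n
  rw [iteratedDeriv_eq_iteratedFDeriv, ← h1]
  simp

lemma taylorCoeff_eq (h : IsSumOn a f R) (hR : 0 < R) : taylorCoeff f = a := by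
  funext n
  rw [taylorCoeff, h.iteratedDeriv_eq hR]
  exact mul_div_cancel_left₀ _ (Nat.cast_ne_zero.2 n.factorial_ne_zero)

lemma differentiableOn (h : IsSumOn a f R) (hR : 0 < R) :
    DifferentiableOn ℂ f (Metric.ball 0 R) := by
  have := (h.hasFPowerSeriesOnBall hR).differentiableOn
  rwa [Metric.eball_ofReal] at this

lemma of_differentiableOn (h : DifferentiableOn ℂ f (Metric.ball 0 R)) :
    IsSumOn (taylorCoeff f) f R := by
  intro z hz
  have h1 := Complex.hasSum_taylorSeries_on_ball h (z := z) (by simpa using hz)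
  refine h1.congr_fun fun n => ?_
  simp only [taylorCoeff, sub_zero, smul_eq_mul]
  ring

lemma deriv (h : IsSumOn a f R) (hR : 0 < R) :
    IsSumOn (fun n => (n + 1) * a (n + 1)) (deriv f) R := by
  have h1 := of_differentiableOn ((h.differentiableOn hR).deriv Metric.isOpen_ball)
  convert h1 using 1
  funext n
  rw [taylorCoeff, ← iteratedDeriv_succ', h.iteratedDeriv_eq hR, Nat.factorial_succ]
  have := Nat.cast_ne_zero (R := ℂ).2 n.factorial_ne_zero
  push_cast
  field_simp

lemma mul (h : IsSumOn a f R) (h' : IsSumOn c g R) :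
    IsSumOn (fun n => ∑ p ∈ Finset.HasAntidiagonal.antidiagonal n, a p.1 * c p.2)
      (fun z => f z * g z) R := by
  intro z hz
  have h1 := summable_norm_sum_mul_antidiagonal_of_summable_norm (h.summable_norm hz)
    (h'.summable_norm hz)
  have h2 := tsum_mul_tsum_eq_tsum_sum_antidiagonal_of_summable_norm (h.summable_norm hz)
    (h'.summable_norm hz)
  rw [(h z hz).tsum_eq, (h' z hz).tsum_eq] at h2
  have h3 := h1.of_norm.hasSum
  rw [← h2] at h3
  refine h3.congr_fun fun n => ?_
  rw [Finset.sum_mul]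
  refine Finset.sum_congr rfl fun p hp => ?_
  rw [← Finset.HasAntidiagonal.mem_antidiagonal.1 hp, pow_add]
  ring

lemma congr (h : IsSumOn a f R) (hfg : ∀ z, ‖z‖ < R → f z = g z) : IsSumOn a g R :=
  fun z hz => hfg z hz ▸ h z hz

lemma eulerDeriv (h : IsSumOn a f R) (hR : 0 < R) :
    IsSumOn (fun n => n * a n) (fun z => z * _root_.deriv f z) R := by
  intro z hz
  have h1 := (h.deriv hR z hz).mul_left z
  rw [← hasSum_nat_add_iff' 1]
  simp only [Finset.range_one, Finset.sum_singleton, Nat.cast_zero, zero_mul, sub_zero]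
  refine h1.congr_fun fun n => ?_
  push_cast
  ring

end IsSumOn

lemma isSumOn_of_bounded {a : ℕ → ℝ} {M : ℝ} (h : ∀ n, |a n| ≤ M) :
    IsSumOn (fun n => (a n : ℂ)) (fun z => ∑' n, (a n : ℂ) * z ^ n) 1 := by
  intro z hz
  refine Summable.hasSum (Summable.of_norm_bounded
    ((summable_geometric_of_lt_one (norm_nonneg z) hz).mul_left M) fun n => ?_)
  rw [norm_mul, norm_pow, Complex.norm_real]
  exact mul_le_mul_of_nonneg_right (h n) (by positivity)

lemma ofReal_coeff_mul (p r : PowerSeries ℝ) (n : ℕ) :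
    ((PowerSeries.coeff n (p * r) : ℝ) : ℂ) =
      ∑ q ∈ Finset.HasAntidiagonal.antidiagonal n,
        ((PowerSeries.coeff q.1 p : ℝ) : ℂ) * ((PowerSeries.coeff q.2 r : ℝ) : ℂ) := by
  rw [PowerSeries.coeff_mul]; push_cast; rfl

namespace IsKaluzaPair

variable {b h : ℕ → ℝ} {L : ℝ}

lemma isSumOn_b (hK : IsKaluzaPair b h L) :
    IsSumOn (fun n => (b n : ℂ)) (fun z => ∑' n, (b n : ℂ) * z ^ n) 1 :=
  isSumOn_of_bounded (M := 1) fun n => by rw [abs_of_pos (hK.pos n)]; exact hK.le_one n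

lemma isSumOn_hb (hK : IsKaluzaPair b h L) :
    IsSumOn (fun n => ((h n * b n : ℝ) : ℂ)) (fun z => ∑' n, ((h n * b n : ℝ) : ℂ) * z ^ n) 1 :=
  isSumOn_of_bounded (M := L) fun n => by
    rw [abs_of_nonneg (mul_nonneg (hK.h_nonneg n) (hK.pos n).le)]
    have h1 := mul_le_mul (hK.h_le n) (hK.le_one n) (hK.pos n).le
      ((hK.h_nonneg 0).trans (hK.h_le 0))
    linarith

/-- Since 0 ≤ a_n ≤ 1, the formal inverse has bounded coefficients and converges on the unit disk;
the formal identity becomes an identity of functions, which excludes zeros of the denominator. -/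
lemma isSumOn_inv (hK : IsKaluzaPair b h L) :
    (∀ z : ℂ, ‖z‖ < 1 → ∑' n, (b n : ℂ) * z ^ n ≠ 0) ∧
    IsSumOn (fun n => ((PowerSeries.coeff n (1 - PowerSeries.mk (recipSeq b)) : ℝ) : ℂ))
      (fun z => (∑' n, (b n : ℂ) * z ^ n)⁻¹) 1 := by
  have h1 := isSumOn_of_bounded (M := 2)
    (a := fun n => PowerSeries.coeff n (1 - PowerSeries.mk (recipSeq b))) fun n => by
      have h2 := hK.recip_nonneg n
      have h3 := (hK.recip_le n).trans (hK.le_one n)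
      rw [map_sub, PowerSeries.coeff_one, PowerSeries.coeff_mk, abs_le]
      split_ifs <;> constructor <;> linarith
  have h2 := hK.isSumOn_b.mul h1
  have h3 : ∀ z : ℂ, ‖z‖ < 1 → (∑' n, (b n : ℂ) * z ^ n) *
      (∑' n, ((PowerSeries.coeff n (1 - PowerSeries.mk (recipSeq b)) : ℝ) : ℂ) * z ^ n) = 1 := by
    intro z hz
    refine (h2 z hz).unique ?_
    have h4 : ∀ n, (∑ p ∈ Finset.HasAntidiagonal.antidiagonal n, (b p.1 : ℂ) *
        ((PowerSeries.coeff p.2 (1 - PowerSeries.mk (recipSeq b)) : ℝ) : ℂ)) =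
        if n = 0 then 1 else 0 := by
      intro n
      have h5 := ofReal_coeff_mul (PowerSeries.mk b) (1 - PowerSeries.mk (recipSeq b)) n
      rw [mk_mul_one_sub_recipSeq hK.zero, PowerSeries.coeff_one] at h5
      simp only [PowerSeries.coeff_mk] at h5
      rw [← h5]
      split_ifs <;> simp
    simp only [h4]
    convert hasSum_single (f := fun n : ℕ => (if n = 0 then (1 : ℂ) else 0) * z ^ n) 0 ?_ using 1
    · simp
    · intro n hn; simp [hn]
  exact ⟨fun z hz => left_ne_zero_of_mul_eq_one (h3 z hz),
    h1.congr fun z hz => eq_inv_of_mul_eq_one_right (h3 z hz)⟩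

lemma isSumOn_quot (hK : IsKaluzaPair b h L) :
    IsSumOn (fun n => (quotSeq b h n : ℂ))
      (fun z => (∑' n, ((h n * b n : ℝ) : ℂ) * z ^ n) / ∑' n, (b n : ℂ) * z ^ n) 1 := by
  have h1 := hK.isSumOn_hb.mul hK.isSumOn_inv.2
  simp only [div_eq_mul_inv]
  convert h1 using 1
  funext n
  have h2 := ofReal_coeff_mul (PowerSeries.mk (fun n => h n * b n))
    (1 - PowerSeries.mk (recipSeq b)) n
  rw [← mk_quotSeq] at h2
  simpa using h2

end IsKaluzaPair

/-- The exponential of a real power series without constant term: the coefficients `e` satisfy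
`e' = g' e`. -/
lemma exists_exp_coeff {g : ℕ → ℝ} {f : ℂ → ℂ} (hf : IsSumOn (fun n => (g n : ℂ)) f 1)
    (hg : g 0 = 0) :
    ∃ e : ℕ → ℝ, e 0 = 1 ∧
      (∀ n : ℕ, (n : ℝ) * e n =
        ∑ p ∈ Finset.HasAntidiagonal.antidiagonal n, (p.1 * g p.1) * e p.2) ∧
      IsSumOn (fun n => (e n : ℂ)) (fun z => Complex.exp (f z)) 1 := by
  have hd : DifferentiableOn ℂ (fun z => Complex.exp (f z)) (Metric.ball 0 1) :=
    (hf.differentiableOn one_pos).cexp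
  set t := taylorCoeff (fun z => Complex.exp (f z)) with ht
  have hsum : IsSumOn t (fun z => Complex.exp (f z)) 1 := IsSumOn.of_differentiableOn hd
  have hrec : ∀ n : ℕ, (n : ℂ) * t n =
      ∑ p ∈ Finset.HasAntidiagonal.antidiagonal n, (p.1 * (g p.1 : ℂ)) * t p.2 := by
    have h1 := hsum.eulerDeriv one_pos
    have h2 := ((hf.eulerDeriv one_pos).mul hsum).congr
      (g := fun z => z * deriv (fun z => Complex.exp (f z)) z) (fun z hz => by
        have h3 : DifferentiableAt ℂ f z := (hf.differentiableOn one_pos).differentiableAt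
          (Metric.isOpen_ball.mem_nhds (by simpa using hz))
        rw [(h3.hasDerivAt.cexp).deriv]
        ring)
    have h3 := (h1.taylorCoeff_eq one_pos).symm.trans (h2.taylorCoeff_eq one_pos)
    exact fun n => congrFun h3 n
  have ht0 : t 0 = 1 := by
    have h0 : f 0 = 0 := by
      have h1 := hf.iteratedDeriv_eq one_pos 0
      simpa [hg] using h1
    simp [ht, taylorCoeff, h0]
  -- The recurrence expresses n t_n through real multiples of earlier coefficients; the term with
  -- index `n` itself carries the factor `p.1 = 0`.
  have him : ∀ n, (t n).im = 0 := by
    intro n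
    induction n using Nat.strong_induction_on with
    | _ n ih =>
      rcases Nat.eq_zero_or_pos n with rfl | hn
      · simp [ht0]
      have h1 := congrArg Complex.im (hrec n)
      rw [Complex.im_sum, Finset.sum_eq_zero] at h1
      · have hn' : (n : ℝ) ≠ 0 := by positivity
        simpa [hn.ne'] using h1
      · intro p hp
        rcases Nat.eq_zero_or_pos p.1 with h0 | h0
        · simp [h0]
        have := ih p.2 (by have := Finset.HasAntidiagonal.mem_antidiagonal.1 hp; omega)
        rw [← Complex.ofReal_natCast, ← Complex.ofReal_mul, Complex.im_ofReal_mul, this, mul_zero]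
  have hre : ∀ n, t n = ((t n).re : ℂ) := fun n => by
    apply Complex.ext <;> simp [him]
  refine ⟨fun n => (t n).re, by simp [ht0], fun n => ?_, ?_⟩
  · have h1 := congrArg Complex.re (hrec n)
    rw [Complex.re_sum] at h1
    rw [← Complex.ofReal_natCast, Complex.re_ofReal_mul] at h1
    rw [h1]
    refine Finset.sum_congr rfl fun p _ => ?_
    rw [← Complex.ofReal_natCast, ← Complex.ofReal_mul, Complex.re_ofReal_mul]
  · convert hsum using 2 with n
    exact (hre n).symm

/-! ### Behaviour on the circle of convergence -/

/-- If a power series with non-negative coefficients extends analytically through the point of its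
circle of convergence on the positive axis, then it converges there, together with all its
derivatives. -/
lemma summable_of_analyticAt {R : ℝ} (hR : 0 < R) (j : ℕ) : ∀ {a : ℕ → ℝ} {f g : ℂ → ℂ},
    (∀ n, 0 ≤ a n) → IsSumOn (fun n => (a n : ℂ)) f R → AnalyticAt ℂ g R →
    f =ᶠ[𝓝[Metric.ball 0 R] (R : ℂ)] g → Summable (fun n : ℕ => (n : ℝ) ^ j * (a n * R ^ n)) := by
  induction j with
  | zero =>
    intro a f g ha hf hg hfg
    simp only [pow_zero, one_mul]
    obtain ⟨M, hM⟩ := hg.continuousAt.norm.isBoundedUnder_le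
    rw [eventually_map] at hM
    have hmap : Tendsto (fun x : ℝ => (x : ℂ)) (𝓝[<] R) (𝓝[Metric.ball 0 R] (R : ℂ)) := by
      refine tendsto_nhdsWithin_iff.2
        ⟨(Complex.continuous_ofReal.tendsto R).mono_left nhdsWithin_le_nhds, ?_⟩
      filter_upwards [Ioo_mem_nhdsLT hR] with x hx
      simpa [abs_of_pos hx.1] using hx.2
    have hev : ∀ᶠ x : ℝ in 𝓝[<] R, ‖f x‖ ≤ M := by
      have h1 := hmap.eventually hfg
      have h2 := hmap.eventually (hM.filter_mono nhdsWithin_le_nhds)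
      filter_upwards [h1, h2] with x hx1 hx2
      rw [hx1]; exact hx2
    -- The continuation is bounded by `M` near `R`; for x < R close to `R` each partial sum of
    -- non-negative terms is at most |f x| ≤ M, and x tends to `R`.
    refine summable_of_sum_range_le (c := M) (fun n => mul_nonneg (ha n) (by positivity))
      fun n => ?_
    have hcont : Tendsto (fun x : ℝ => ∑ i ∈ Finset.range n, a i * x ^ i) (𝓝[<] R)
        (𝓝 (∑ i ∈ Finset.range n, a i * R ^ i)) :=
      ((by fun_prop : Continuous fun x : ℝ => ∑ i ∈ Finset.range n, a i * x ^ i).tendsto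
        R).mono_left nhdsWithin_le_nhds
    refine le_of_tendsto hcont ?_
    filter_upwards [hev, Ioo_mem_nhdsLT hR] with x hx1 hx2
    have h1 := hf x (by simpa [abs_of_pos hx2.1] using hx2.2)
    have h2 := Complex.hasSum_re h1
    have h3 : ∀ n, ((a n : ℂ) * (x : ℂ) ^ n).re = a n * x ^ n := fun n => by
      rw [← Complex.ofReal_pow, ← Complex.ofReal_mul, Complex.ofReal_re]
    simp only [h3] at h2
    exact (sum_le_hasSum _ (fun i _ => mul_nonneg (ha i) (pow_nonneg hx2.1.le _)) h2).trans
      ((Complex.re_le_norm _).trans hx1)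
  | succ j ih =>
    intro a f g ha hf hg hfg
    -- The operator z d/dz multiplies the coefficients by `n` and preserves both the signs and the
    -- analytic continuation, so the induction hypothesis applies to it.
    have h1 := hf.eulerDeriv hR
    have h2 : (fun z => z * deriv f z) =ᶠ[𝓝[Metric.ball 0 R] (R : ℂ)] (fun z => z * deriv g z) := by
      rw [EventuallyEq, eventually_nhdsWithin_iff] at hfg ⊢
      filter_upwards [hfg.eventually_nhds] with z hz hzm
      have h3 : f =ᶠ[𝓝 z] g := by
        filter_upwards [hz, Metric.isOpen_ball.mem_nhds hzm] with y hy1 hy2 using hy1 hy2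
      rw [h3.deriv_eq]
    have h3 := ih (a := fun n => n * a n) (fun n => mul_nonneg n.cast_nonneg (ha n))
      (by simpa using h1) (analyticAt_id.mul hg.deriv) h2
    refine h3.congr fun n => ?_
    ring

lemma exists_boundary_value {a : ℕ → ℝ} {f : ℂ → ℂ} {R : ℝ} (ha : ∀ n, 0 ≤ a n)
    (hf : IsSumOn (fun n => (a n : ℂ)) f R) (hs : Summable (fun n => a n * R ^ n))
    {z : ℂ} (hz : ‖z‖ = R) :
    ∃ w : ℂ, HasSum (fun n => (a n : ℂ) * z ^ n) w ∧
      Tendsto f (𝓝[Metric.ball 0 R] z) (𝓝 w) := by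
  have hb : ∀ n (y : ℂ), y ∈ Metric.closedBall (0 : ℂ) R → ‖(a n : ℂ) * y ^ n‖ ≤ a n * R ^ n := by
    intro n y hy
    rw [norm_mul, norm_pow, Complex.norm_real, Real.norm_of_nonneg (ha n)]
    gcongr
    · exact ha n
    · simpa using hy
  have hzm : z ∈ Metric.closedBall (0 : ℂ) R := by simp [hz]
  have hcont : ContinuousOn (fun y : ℂ => ∑' n, (a n : ℂ) * y ^ n) (Metric.closedBall 0 R) :=
    continuousOn_tsum (fun n => by fun_prop) hs hb
  refine ⟨∑' n, (a n : ℂ) * z ^ n,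
    (Summable.of_norm_bounded hs fun n => hb n z hzm).hasSum, ?_⟩
  have h1 : Tendsto (fun y : ℂ => ∑' n, (a n : ℂ) * y ^ n) (𝓝[Metric.ball 0 R] z)
      (𝓝 (∑' n, (a n : ℂ) * z ^ n)) :=
    (hcont z hzm).mono_left (nhdsWithin_mono _ Metric.ball_subset_closedBall)
  refine h1.congr' ?_
  filter_upwards [self_mem_nhdsWithin] with y hy
  exact (hf y (by simpa using hy)).tsum_eq

/-! ### The weights n^(-s) and 1/(n log² n) -/

section weights

lemma isTempered_rpow {s : ℝ} (hs : 0 ≤ s) : IsTempered (fun n : ℕ => ((n : ℝ) + 1) ^ (-s)) where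
  pos n := by positivity
  ratio := by
    have h1 : Tendsto (fun n : ℕ => 1 + 1 / ((n : ℝ) + 1)) atTop (𝓝 (1 + 0)) :=
      tendsto_const_nhds.add tendsto_one_div_add_atTop_nhds_zero_nat
    rw [add_zero] at h1
    have h2 := h1.rpow_const (p := -s) (Or.inl one_ne_zero)
    rw [Real.one_rpow] at h2
    refine h2.congr fun n => ?_
    rw [← Real.div_rpow (by positivity) (by positivity)]
    congr 1
    push_cast
    field_simp
  doubling := by
    refine ⟨2 ^ s, by positivity, fun n j h1 h2 => ?_⟩
    have h1' : (n : ℝ) ≤ 2 * j := by exact_mod_cast h1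
    rw [Real.rpow_neg (by positivity), Real.rpow_neg (by positivity), ← div_eq_mul_inv,
      ← Real.div_rpow (by positivity) (by positivity), ← Real.inv_rpow (by positivity)]
    refine Real.rpow_le_rpow (by positivity) ?_ hs
    rw [inv_eq_one_div, div_le_div_iff₀ (by positivity) (by positivity)]
    linarith

lemma summable_rpow_weight {s : ℝ} (hs : 1 < s) :
    Summable (fun n : ℕ => ((n : ℝ) + 1) ^ (-s)) := by
  have := (summable_nat_add_iff (f := fun n : ℕ => (n : ℝ) ^ (-s)) 1).2
    (Real.summable_nat_rpow.2 (by linarith))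
  simpa using this

lemma tendsto_succ_mul_rpow_weight {s : ℝ} (hs : 1 < s) :
    Tendsto (fun n : ℕ => ((n : ℝ) + 1) * ((n : ℝ) + 1) ^ (-s)) atTop (𝓝 0) := by
  have h1 := (tendsto_rpow_neg_atTop (y := s - 1) (by linarith)).comp
    (tendsto_atTop_add_const_right _ (1 : ℝ) tendsto_natCast_atTop_atTop)
  refine h1.congr fun n => ?_
  have : (0 : ℝ) < n + 1 := by positivity
  simp only [Function.comp]
  rw [← Real.rpow_one_add' this.le (by linarith)]
  congr 1
  ring

lemma log_add_two_pos (n : ℕ) : 0 < Real.log ((n : ℝ) + 2) :=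
  Real.log_pos (by linarith [n.cast_nonneg (α := ℝ)])

lemma tendsto_log_add_two : Tendsto (fun n : ℕ => Real.log ((n : ℝ) + 2)) atTop atTop :=
  Real.tendsto_log_atTop.comp
    (tendsto_atTop_add_const_right _ (2 : ℝ) tendsto_natCast_atTop_atTop)

lemma tendsto_log_sq_div : Tendsto (fun n : ℕ => Real.log ((n : ℝ) + 2) ^ 2 / ((n : ℝ) + 1))
    atTop (𝓝 0) := by
  have h1 := (isLittleO_log_rpow_rpow_atTop (s := 1) 2 one_pos).tendsto_div_nhds_zero.comp
    (tendsto_atTop_add_const_right _ (2 : ℝ) (tendsto_natCast_atTop_atTop (R := ℝ)))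
  have h2 : Tendsto (fun n : ℕ => 1 + 1 / ((n : ℝ) + 1)) atTop (𝓝 (1 + 0)) :=
    tendsto_const_nhds.add tendsto_one_div_add_atTop_nhds_zero_nat
  have h3 := h1.mul h2
  rw [zero_mul] at h3
  refine h3.congr fun n => ?_
  simp only [Function.comp, Real.rpow_one, Real.rpow_two]
  field_simp
  ring

lemma isTempered_logWeight : IsTempered (fun n : ℕ => 1 / Real.log ((n : ℝ) + 2) ^ 2) where
  pos n := by have := log_add_two_pos n; positivity
  ratio := by
    have h1 : Tendsto (fun n : ℕ => Real.log ((n : ℝ) + 2) / Real.log ((n : ℝ) + 1 + 2)) atTop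
        (𝓝 1) := by
      have h2 : Tendsto (fun n : ℕ => Real.log (1 + 1 / ((n : ℝ) + 2)) / Real.log ((n : ℝ) + 2))
          atTop (𝓝 0) := by
        refine squeeze_zero (fun n => ?_) (fun n => ?_) (tendsto_log_add_two.inv_tendsto_atTop)
        · exact div_nonneg (Real.log_nonneg (by simp; positivity)) (log_add_two_pos n).le
        · have h3 := log_add_two_pos n
          simp only [Pi.inv_apply]
          rw [div_eq_mul_inv]
          refine mul_le_of_le_one_left (by positivity) ?_
          have h4 : (0 : ℝ) < n + 2 := by positivity
          refine (Real.log_le_sub_one_of_pos (by positivity)).trans ?_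
          rw [add_sub_cancel_left, div_le_one h4]
          linarith [n.cast_nonneg (α := ℝ)]
      have h3 := (h2.const_add 1).inv₀ (by norm_num)
      rw [add_zero, inv_one] at h3
      refine h3.congr fun n => ?_
      have h4 := log_add_two_pos n
      have h5 : (n : ℝ) + 1 + 2 = (n + 2) * (1 + 1 / (n + 2)) := by field_simp; ring
      rw [h5, Real.log_mul (by positivity) (by positivity), ← inv_div]
      field_simp
    have h2 := h1.pow 2
    rw [one_pow] at h2
    refine h2.congr fun n => ?_
    rw [div_pow]
    push_cast
    rw [div_div_div_eq, one_mul, mul_one]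
  doubling := by
    refine ⟨4, by norm_num, fun n j h1 h2 => ?_⟩
    have h3 := log_add_two_pos n
    have h4 := log_add_two_pos j
    have h1' : (n : ℝ) ≤ 2 * j := by exact_mod_cast h1
    -- From n ≤ 2j one gets n + 2 ≤ (j + 2)²; squaring the logarithms gives the doubling constant 4.
    have h5 : Real.log ((n : ℝ) + 2) ≤ 2 * Real.log ((j : ℝ) + 2) := by
      rw [← Real.log_rpow (by positivity), Real.rpow_two]
      refine Real.log_le_log (by positivity) ?_
      nlinarith [j.cast_nonneg (α := ℝ)]
    rw [mul_one_div, div_le_div_iff₀ (by positivity) (by positivity), one_mul]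
    nlinarith

lemma tendsto_logWeight : Tendsto (fun n : ℕ => 1 / Real.log ((n : ℝ) + 2) ^ 2) atTop (𝓝 0) := by
  have h1 := ((tendsto_pow_atTop two_ne_zero).comp tendsto_log_add_two).inv_tendsto_atTop
  refine h1.congr fun n => ?_
  simp

lemma tendsto_succ_mul_logWeight :
    Tendsto (fun n : ℕ => ((n : ℝ) + 1) * (1 / Real.log ((n : ℝ) + 2) ^ 2)) atTop atTop := by
  have h1 : Tendsto (fun n : ℕ => Real.log ((n : ℝ) + 2) ^ 2 / ((n : ℝ) + 1)) atTop (𝓝[>] 0) :=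
    tendsto_nhdsWithin_iff.2 ⟨tendsto_log_sq_div, Eventually.of_forall fun n => by
      have := log_add_two_pos n
      simp only [Set.mem_Ioi]; positivity⟩
  refine h1.inv_tendsto_nhdsGT_zero.congr fun n => ?_
  simp [div_eq_mul_inv, mul_comm]

lemma isTempered_succ_inv_mul {v : ℕ → ℝ} (hv : IsTempered v) :
    IsTempered (fun n => v n / ((n : ℝ) + 1)) where
  pos n := div_pos (hv.pos n) (by positivity)
  ratio := by
    have h1 : Tendsto (fun n : ℕ => 1 + 1 / ((n : ℝ) + 1)) atTop (𝓝 (1 + 0)) :=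
      tendsto_const_nhds.add tendsto_one_div_add_atTop_nhds_zero_nat
    have h2 := hv.ratio.div h1 (by norm_num)
    rw [add_zero, div_one] at h2
    refine h2.congr fun n => ?_
    have := (hv.pos n).ne'
    simp only [Pi.div_apply]
    push_cast
    field_simp
  doubling := by
    obtain ⟨K, hK0, hK⟩ := hv.doubling
    refine ⟨2 * K, by positivity, fun n j h1 h2 => ?_⟩
    have h1' : (n : ℝ) ≤ 2 * j := by exact_mod_cast h1
    have h3 := (hv.pos n).le
    have h4 : v j / ((j : ℝ) + 1) ≤ K * v n / ((j : ℝ) + 1) :=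
      div_le_div_of_nonneg_right (hK n j h1 h2) (by positivity)
    refine h4.trans ?_
    rw [← mul_div_assoc, div_le_div_iff₀ (by positivity) (by positivity)]
    have h5 : (n : ℝ) + 1 ≤ 2 * (j + 1) := by linarith
    have := mul_le_mul_of_nonneg_left h5 (mul_nonneg hK0 h3)
    linarith

end weights

/-! ### Coefficients of the exponential -/

section exponential

variable {b h : ℕ → ℝ} {L : ℝ}

namespace IsKaluzaPair

lemma exp_nonneg (hK : IsKaluzaPair b h L) {e : ℕ → ℝ} (h0 : e 0 = 1)
    (hrec : ∀ n : ℕ, (n : ℝ) * e n =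
        ∑ p ∈ Finset.HasAntidiagonal.antidiagonal n, (p.1 * quotSeq b h p.1) * e p.2) (n : ℕ) :
    0 ≤ e n := by
  induction n using Nat.strong_induction_on with
  | _ n ih =>
    rcases Nat.eq_zero_or_pos n with rfl | hn
    · rw [h0]; exact zero_le_one
    have h1 : 0 ≤ (n : ℝ) * e n := by
      rw [hrec n]
      refine Finset.sum_nonneg fun p hp => ?_
      rcases Nat.eq_zero_or_pos p.1 with h2 | h2
      · simp [h2]
      · exact mul_nonneg (mul_nonneg p.1.cast_nonneg (hK.quot_nonneg _))
          (ih _ (by have := Finset.HasAntidiagonal.mem_antidiagonal.1 hp; omega))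
    exact nonneg_of_mul_nonneg_right h1 (by exact_mod_cast hn)

/-- On (0,1) the bound h_n ≤ L shows that the quotient is at most `L`; partial sums of the
non-negative series for its exponential stay below exp L, and x tends to 1. -/
lemma sum_exp_le (hK : IsKaluzaPair b h L) {e : ℕ → ℝ} (he : ∀ n, 0 ≤ e n)
    (hs : IsSumOn (fun n => (e n : ℂ)) (fun z => Complex.exp
      ((∑' n, ((h n * b n : ℝ) : ℂ) * z ^ n) / ∑' n, (b n : ℂ) * z ^ n)) 1) (n : ℕ) :
    ∑ i ∈ Finset.range n, e i ≤ Real.exp L := by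
  have hcont : Tendsto (fun x : ℝ => ∑ i ∈ Finset.range n, e i * x ^ i) (𝓝[<] 1)
      (𝓝 (∑ i ∈ Finset.range n, e i * 1 ^ i)) :=
    ((by fun_prop : Continuous fun x : ℝ => ∑ i ∈ Finset.range n, e i * x ^ i).tendsto
      1).mono_left nhdsWithin_le_nhds
  simp only [one_pow, mul_one] at hcont
  refine le_of_tendsto hcont ?_
  filter_upwards [Ioo_mem_nhdsLT (zero_lt_one (α := ℝ))] with x hx
  have hx1 : ‖(x : ℂ)‖ < 1 := by simpa [abs_of_pos hx.1] using hx.2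
  have h2 := Complex.hasSum_re (hs x hx1)
  have h3 : ∀ (e : ℕ → ℝ) n, ((e n : ℂ) * (x : ℂ) ^ n) = ((e n * x ^ n : ℝ) : ℂ) := fun e n => by
    push_cast; rfl
  simp only [h3, Complex.ofReal_re, ← Complex.ofReal_tsum] at h2
  have h4 : ∀ n : ℕ, (((h n * b n : ℝ) : ℂ) * (x : ℂ) ^ n) = ((h n * b n * x ^ n : ℝ) : ℂ) :=
    fun n => by push_cast; rfl
  simp only [h4, ← Complex.ofReal_tsum, ← Complex.ofReal_div, ← Complex.ofReal_exp,
    Complex.ofReal_re] at h2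
  refine (sum_le_hasSum _ (fun i _ => mul_nonneg (he i) (pow_nonneg hx.1.le _)) h2).trans
    (Real.exp_le_exp.2 ?_)
  have hbs : Summable (fun n => b n * x ^ n) := by
    have := (hK.isSumOn_b x hx1).summable
    simp only [h3] at this
    exact_mod_cast this
  have hhs : Summable (fun n => h n * b n * x ^ n) := by
    have := (hK.isSumOn_hb x hx1).summable
    simp only [h4] at this
    exact_mod_cast this
  have hpos : 0 < ∑' n, b n * x ^ n :=
    hbs.tsum_pos (fun n => mul_nonneg (hK.pos n).le (pow_nonneg hx.1.le _)) 0
      (by simp [hK.zero])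
  rw [div_le_iff₀ hpos, ← tsum_mul_left]
  refine hhs.tsum_le_tsum (fun n => ?_) (hbs.mul_left L)
  rw [mul_assoc]
  exact mul_le_mul_of_nonneg_right (hK.h_le n) (mul_nonneg (hK.pos n).le (pow_nonneg hx.1.le _))

/-- The coefficients of the exponential inherit the asymptotics of the coefficients `a`. -/
lemma tendsto_exp (hK : IsKaluzaPair b h L) {e w : ℕ → ℝ} {α : ℝ} (he0 : e 0 = 1)
    (he : ∀ n, 0 ≤ e n) (hes : Summable e)
    (hrec : ∀ n : ℕ, (n : ℝ) * e n =
      ∑ p ∈ Finset.HasAntidiagonal.antidiagonal n, (p.1 * quotSeq b h p.1) * e p.2)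
    (hw : IsTempered w) (hws : Summable w)
    (hw0 : Tendsto (fun n : ℕ => ((n : ℝ) + 1) * w n) atTop (𝓝 0)) (hα : 0 < α)
    (ha : Tendsto (fun n => recipSeq b n / w n) atTop (𝓝 α))
    (hd : Tendsto (fun n => (L - h n) * b n / w n) atTop (𝓝 0)) :
    ∃ c, 0 < c ∧ Tendsto (fun n => e n / w n) atTop (𝓝 c) := by
  have hdpos : ∀ n, 0 < (L - h n) * b n := fun n =>
    mul_pos (sub_pos.2 (hK.h_lt n)) (hK.pos n)
  have hds : Summable (fun n => (L - h n) * b n) := by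
    have := (dominatedBy_of_tendsto hw.pos hd).summable hws
    simpa only [abs_of_pos (hdpos _)] using this
  have hD : 0 < ∑' n, (L - h n) * b n := hds.tsum_pos (fun n => (hdpos n).le) 0 (hdpos 0)
  have hy : Tendsto (fun n => PowerSeries.coeff n (1 - PowerSeries.mk (recipSeq b)) / w n) atTop
      (𝓝 (-α)) := by
    refine ha.neg.congr' ?_
    filter_upwards [eventually_gt_atTop 0] with n hn
    simp [PowerSeries.coeff_one, hn.ne', neg_div]
  -- The factor (L - h_n) b_n has limit 0 relative to `w`, so only its total mass, multiplied by the
  -- limit -α of the other factor, survives.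
  have h1 := (tendsto_convolution hw hws hd hy).neg
  rw [zero_mul, add_zero, neg_mul, neg_neg] at h1
  have h2 : Tendsto (fun n => quotSeq b h n / w n) atTop (𝓝 (α * ∑' n, (L - h n) * b n)) := by
    refine h1.congr' ?_
    filter_upwards [eventually_gt_atTop 0] with n hn
    have h3 := congrArg (PowerSeries.coeff n) hK.mk_quotSeq_eq_sub
    rw [map_sub, PowerSeries.coeff_mul] at h3
    simp only [PowerSeries.coeff_mk, PowerSeries.coeff_C, hn.ne', if_false, zero_sub] at h3
    rw [h3, neg_div]
  have h3 : DominatedBy e w := dominatedBy_of_log_derivative hw hw0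
    (dominatedBy_of_tendsto hw.pos h2) (by simpa only [abs_of_nonneg (he _)] using hes) hrec
  exact ⟨_, mul_pos (mul_pos hα hD) (hes.tsum_pos he 0 (by simp [he0])),
    tendsto_of_derivative_eq hw hws hw0 h2 h3 hrec⟩

end IsKaluzaPair

end exponential

/-! ### Asymptotics of the reciprocal series -/

section recipAsymptotics

variable {b h : ℕ → ℝ} {L : ℝ}

lemma coeff_X_mul_derivative (p : PowerSeries ℝ) (n : ℕ) :
    PowerSeries.coeff n (PowerSeries.X * PowerSeries.derivative ℝ p) =
      n * PowerSeries.coeff n p := by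
  rcases n with _ | n
  · simp
  · rw [PowerSeries.coeff_succ_X_mul, PowerSeries.coeff_derivative]
    push_cast; ring

/-- This is A' = B'/B² for A = 1 - 1/B, with 1/B written as 1 - A. -/
lemma derivative_recipSeq (hb : b 0 = 1) :
    PowerSeries.derivative ℝ (PowerSeries.mk (recipSeq b)) =
      PowerSeries.derivative ℝ (PowerSeries.mk b) *
        ((1 - PowerSeries.mk (recipSeq b)) * (1 - PowerSeries.mk (recipSeq b))) := by
  have h1 := mk_mul_one_sub_recipSeq hb
  have h2 := congrArg (PowerSeries.derivative ℝ) h1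
  rw [Derivation.leibniz] at h2
  simp only [map_sub, Derivation.map_one_eq_zero, smul_eq_mul, zero_sub] at h2
  linear_combination (-(1 - PowerSeries.mk (recipSeq b))) * h2 +
    (-PowerSeries.derivative ℝ (PowerSeries.mk (recipSeq b))) * h1

namespace IsKaluzaPair

/-- The summable case. -/
lemma tendsto_recip_of_summable (hK : IsKaluzaPair b h L) {w : ℕ → ℝ} {κ : ℝ} (hw : IsTempered w)
    (hws : Summable w) (hw0 : Tendsto (fun n : ℕ => ((n : ℝ) + 1) * w n) atTop (𝓝 0))
    (hκ : 0 < κ) (hb : Tendsto (fun n => b n / w n) atTop (𝓝 κ)) :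
    ∃ α, 0 < α ∧ Tendsto (fun n => recipSeq b n / w n) atTop (𝓝 α) := by
  have hbd := dominatedBy_of_tendsto hw.pos hb
  set y : ℕ → ℝ := fun n => PowerSeries.coeff n (1 - PowerSeries.mk (recipSeq b)) with hy
  have hyd : DominatedBy y w := by
    obtain ⟨M, hM0, hM⟩ := hbd
    -- The term `1 / w 0` accounts for the constant coefficient 1; the others are -a_n with 0 ≤ a_n
    -- ≤ b_n.
    refine ⟨M + 1 / w 0, add_nonneg hM0 (by have := hw.pos 0; positivity), fun n => ?_⟩
    have h1 := hM n
    rw [abs_of_pos (hK.pos n)] at h1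
    have h2 := (hK.recip_le n).trans h1
    have h3 := hK.recip_nonneg n
    rcases n with _ | n
    · have h4 := hw.pos 0
      have h5 : 0 ≤ M * w 0 := by positivity
      have h6 : 1 / w 0 * w 0 = 1 := by field_simp
      have h7 : y 0 = 1 := by simp [hy, recipSeq_zero hK.zero]
      rw [h7, add_mul, h6, abs_one]
      linarith
    · have h4 : y (n + 1) = - recipSeq b (n + 1) := by simp [hy, PowerSeries.coeff_one]
      rw [h4, abs_neg, abs_of_nonneg h3, add_mul]
      have := mul_nonneg (one_div_nonneg.2 (hw.pos 0).le) (hw.pos (n + 1)).le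
      linarith
  have hys := hyd.summable hws
  have hbs := hbd.summable hws
  have hsum : (∑' n, b n) * ∑' n, y n = 1 := by
    rw [tsum_mul_tsum_eq_tsum_sum_antidiagonal_of_summable_norm (by simpa using hbs)
      (by simpa using hys)]
    have h1 : ∀ n, ∑ p ∈ Finset.HasAntidiagonal.antidiagonal n, b p.1 * y p.2 =
        if n = 0 then 1 else 0 := by
      intro n
      have h2 := congrArg (PowerSeries.coeff n) (mk_mul_one_sub_recipSeq hK.zero)
      rw [PowerSeries.coeff_mul, PowerSeries.coeff_one] at h2
      simpa only [PowerSeries.coeff_mk] using h2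
    simp only [h1]
    exact tsum_ite_eq 0 _
  have hy2 := hyd.convolution hw hws hyd
  have hrec : ∀ n : ℕ, (n : ℝ) * recipSeq b n = ∑ p ∈ Finset.HasAntidiagonal.antidiagonal n,
      (p.1 * b p.1) * ∑ q ∈ Finset.HasAntidiagonal.antidiagonal p.2, y q.1 * y q.2 := by
    intro n
    have h1 := congrArg (fun p => PowerSeries.coeff n (PowerSeries.X * p))
      (derivative_recipSeq hK.zero)
    simp only [coeff_X_mul_derivative, PowerSeries.coeff_mk, ← mul_assoc] at h1
    rw [h1, mul_assoc, PowerSeries.coeff_mul]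
    refine Finset.sum_congr rfl fun q _ => ?_
    rw [coeff_X_mul_derivative, PowerSeries.coeff_mk, PowerSeries.coeff_mul]
  -- The limit is κ (∑ y)², and ∑ y is non-zero because it is the inverse of ∑ b.
  refine ⟨_, ?_, tendsto_of_derivative_eq hw hws hw0 hb hy2 hrec⟩
  rw [← tsum_mul_tsum_eq_tsum_sum_antidiagonal_of_summable_norm (by simpa using hys)
    (by simpa using hys)]
  exact mul_pos hκ (mul_self_pos.2 (right_ne_zero_of_mul_eq_one hsum))

/-- The tails `1 - a₀ - ⋯ - aₙ`. -/
def tail (b : ℕ → ℝ) (n : ℕ) : ℝ := 1 - ∑ k ∈ Finset.range (n + 1), recipSeq b k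

lemma one_sub_X_mul_mk_tail :
    (1 - PowerSeries.X) * PowerSeries.mk (tail b) = 1 - PowerSeries.mk (recipSeq b) := by
  ext n
  rw [sub_mul, one_mul, map_sub]
  rcases n with _ | n
  · simp [tail]
  · rw [PowerSeries.coeff_succ_X_mul]
    simp [tail, PowerSeries.coeff_one, Finset.sum_range_succ]

/-- The tails have generating function (1 - A)/(1 - X), and B (1 - A) = 1, so the product with B is
1/(1 - X). -/
lemma convolution_tail (hb : b 0 = 1) (n : ℕ) :
    ∑ p ∈ Finset.HasAntidiagonal.antidiagonal n, b p.1 * tail b p.2 = 1 := by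
  have h1 : PowerSeries.mk b * PowerSeries.mk (tail b) = PowerSeries.mk (fun _ => (1 : ℝ)) := by
    have h2 : (1 - PowerSeries.X) * PowerSeries.mk (fun _ => (1 : ℝ)) = 1 := by
      rw [mul_comm]; exact PowerSeries.mk_one_mul_one_sub_eq_one ℝ
    have h3 := mk_mul_one_sub_recipSeq hb
    rw [← one_sub_X_mul_mk_tail] at h3
    linear_combination PowerSeries.mk (fun _ => (1 : ℝ)) * h3 -
      PowerSeries.mk b * PowerSeries.mk (tail b) * h2
  have h2 := congrArg (PowerSeries.coeff n) h1
  rw [PowerSeries.coeff_mul] at h2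
  simpa only [PowerSeries.coeff_mk] using h2

lemma tail_nonneg (hK : IsKaluzaPair b h L) (n : ℕ) : 0 ≤ tail b n :=
  sub_nonneg.2 (hK.sum_recip_le_one _)

lemma tail_antitone (hK : IsKaluzaPair b h L) : Antitone (tail b) := by
  refine antitone_nat_of_succ_le fun n => ?_
  simp only [tail]
  rw [Finset.sum_range_succ _ (n + 1)]
  linarith [hK.recip_nonneg (n + 1)]

lemma tail_mul_sum_le_one (hK : IsKaluzaPair b h L) (n : ℕ) :
    tail b n * ∑ k ∈ Finset.range (n + 1), b k ≤ 1 := by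
  rw [← convolution_tail hK.zero n,
    Finset.Nat.sum_antidiagonal_eq_sum_range_succ (fun i j => b i * tail b j), Finset.mul_sum]
  refine Finset.sum_le_sum fun k _ => ?_
  rw [mul_comm]
  exact mul_le_mul_of_nonneg_left (hK.tail_antitone (Nat.sub_le _ _)) (hK.pos k).le

/-- The convolution identity is taken at index 2n and cut in the middle, so that monotonicity
replaces the factor of large index by its value at `n`. With the upper bound `tail_mul_sum_le_one`
it pins down the product of the tail and the partial sum. -/
lemma one_le_tail_mul_sum (hK : IsKaluzaPair b h L) (n : ℕ) :
    1 ≤ tail b n * ∑ k ∈ Finset.range (n + 1), b k +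
      b n * ∑ j ∈ Finset.range (n + 1), tail b j := by
  rw [← convolution_tail hK.zero (2 * n), sum_antidiagonal_split]
  have h1 : 2 * n / 2 + 1 = n + 1 := by omega
  have h2 : (2 * n + 1) / 2 = n := by omega
  rw [h1, h2, Finset.mul_sum, Finset.mul_sum]
  refine add_le_add (Finset.sum_le_sum fun k hk => ?_) ?_
  · have := Finset.mem_range.1 hk
    rw [mul_comm]
    exact mul_le_mul_of_nonneg_right (hK.tail_antitone (by omega)) (hK.pos k).le
  · rw [Finset.sum_range_succ]
    have h3 : ∑ j ∈ Finset.range n, tail b j * b (2 * n - j) ≤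
        ∑ j ∈ Finset.range n, b n * tail b j := by
      refine Finset.sum_le_sum fun j hj => ?_
      have := Finset.mem_range.1 hj
      rw [mul_comm]
      exact mul_le_mul_of_nonneg_right (hK.antitone (by omega)) (hK.tail_nonneg j)
    have := mul_nonneg (hK.pos n).le (hK.tail_nonneg n)
    linarith

lemma tendsto_sum_div_log {κ : ℝ} (hb : Tendsto (fun n : ℕ => ((n : ℝ) + 1) * b n) atTop (𝓝 κ)) :
    Tendsto (fun n : ℕ => (∑ k ∈ Finset.range (n + 1), b k) / Real.log ((n : ℝ) + 2)) atTop
      (𝓝 κ) := by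
  have hlog := tendsto_log_add_two
  have hharm : Tendsto (fun n : ℕ => (∑ k ∈ Finset.range (n + 1), 1 / ((k : ℝ) + 1)) /
      Real.log ((n : ℝ) + 2)) atTop (𝓝 1) := by
    have h1 := Real.tendsto_harmonic_sub_log_add_one.comp (tendsto_add_atTop_nat 1)
    have h2 := (h1.mul hlog.inv_tendsto_atTop).add_const 1
    rw [mul_zero, zero_add] at h2
    refine h2.congr fun n => ?_
    have h3 := log_add_two_pos n
    have h4 : ((harmonic (n + 1) : ℚ) : ℝ) = ∑ k ∈ Finset.range (n + 1), 1 / ((k : ℝ) + 1) := by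
      simp [harmonic]
    have h5 : (((n + 1 : ℕ) : ℝ) + 1) = n + 2 := by push_cast; ring
    simp only [Function.comp, Pi.inv_apply]
    rw [h4, h5]
    field_simp
    ring
  have hS : Tendsto (fun n : ℕ => ∑ k ∈ Finset.range n, 1 / ((k : ℝ) + 1)) atTop atTop := by
    rw [← tendsto_add_atTop_iff_nat 1]
    have := hlog.atTop_mul_pos one_pos hharm
    refine this.congr fun n => ?_
    rw [mul_div_cancel₀ _ (log_add_two_pos n).ne']
  have ho : (fun k : ℕ => b k - κ * (1 / ((k : ℝ) + 1))) =o[atTop]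
      (fun k : ℕ => 1 / ((k : ℝ) + 1)) := by
    refine (isLittleO_iff_tendsto' (Eventually.of_forall fun k hk => ?_)).2 ?_
    · have : (0 : ℝ) < 1 / ((k : ℝ) + 1) := by positivity
      exact absurd hk this.ne'
    · have h1 := hb.sub_const κ
      rw [sub_self] at h1
      refine h1.congr fun n => ?_
      field_simp
  have h1 := (ho.sum_range (fun n => by positivity) hS).tendsto_div_nhds_zero.comp
    (tendsto_add_atTop_nat 1)
  have h2 := (h1.add_const κ).mul hharm
  rw [zero_add, mul_one] at h2
  refine h2.congr fun n => ?_
  have h3 := log_add_two_pos n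
  have h4 : (0 : ℝ) < ∑ k ∈ Finset.range (n + 1), 1 / ((k : ℝ) + 1) :=
    Finset.sum_pos (fun k _ => by positivity) ⟨0, by simp⟩
  simp only [Function.comp]
  rw [Finset.sum_sub_distrib, ← Finset.mul_sum]
  field_simp
  ring

/-- The tail times the partial sum of b tends to 1, because the error b_n ∑ tail_j is (n+1) b_n
times a Cesàro mean of a null sequence; the partial sums grow like κ log n. -/
lemma tendsto_tail_mul_log (hK : IsKaluzaPair b h L) {κ : ℝ} (hκ : 0 < κ)
    (hb : Tendsto (fun n : ℕ => ((n : ℝ) + 1) * b n) atTop (𝓝 κ)) :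
    Tendsto (fun n : ℕ => tail b n * Real.log ((n : ℝ) + 2)) atTop (𝓝 κ⁻¹) := by
  have hS := tendsto_sum_div_log hb
  have hSpos : ∀ n : ℕ, 0 < ∑ k ∈ Finset.range (n + 1), b k := fun n =>
    Finset.sum_pos (fun k _ => hK.pos k) ⟨0, by simp⟩
  have hSinf : Tendsto (fun n : ℕ => ∑ k ∈ Finset.range (n + 1), b k) atTop atTop := by
    refine (tendsto_log_add_two.atTop_mul_pos hκ hS).congr fun n => ?_
    rw [mul_div_cancel₀ _ (log_add_two_pos n).ne']
  have hT0 : Tendsto (tail b) atTop (𝓝 0) := by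
    refine squeeze_zero hK.tail_nonneg (fun n => ?_) hSinf.inv_tendsto_atTop
    simp only [Pi.inv_apply]
    rw [inv_eq_one_div, le_div_iff₀ (hSpos n)]
    exact hK.tail_mul_sum_le_one n
  have h1 : Tendsto (fun n => tail b n * ∑ k ∈ Finset.range (n + 1), b k) atTop (𝓝 1) := by
    have h2 := ((tendsto_cesaro_zero hT0).mul hb).const_sub 1
    rw [zero_mul, sub_zero] at h2
    refine tendsto_of_tendsto_of_tendsto_of_le_of_le h2 tendsto_const_nhds (fun n => ?_)
      hK.tail_mul_sum_le_one
    have h3 := hK.one_le_tail_mul_sum n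
    simp only [abs_of_nonneg (hK.tail_nonneg _)]
    have h4 : (∑ j ∈ Finset.range (n + 1), tail b j) / ((n : ℝ) + 1) * (((n : ℝ) + 1) * b n) =
        b n * ∑ j ∈ Finset.range (n + 1), tail b j := by field_simp
    rw [h4]
    linarith
  have h2 := h1.div hS hκ.ne'
  rw [one_div] at h2
  refine h2.congr fun n => ?_
  have h3 := log_add_two_pos n
  have h4 := hSpos n
  simp only [Pi.div_apply]
  field_simp

/-- The borderline case `bₙ ∼ κ / n`. -/
lemma tendsto_recip_log (hK : IsKaluzaPair b h L) {κ M : ℝ} (hκ : 0 < κ)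
    (hb : Tendsto (fun n : ℕ => (n : ℝ) * b n) atTop (𝓝 κ))
    (hmono : ∀ n : ℕ, (n : ℝ) * b n ≤ ((n : ℝ) + 1) * b (n + 1))
    (hM : ∀ n : ℕ, ((n : ℝ) + 1) * b (n + 1) - (n : ℝ) * b n ≤ M / ((n : ℝ) + 2) ^ 2) :
    Tendsto (fun n : ℕ => recipSeq b n / (1 / Real.log ((n : ℝ) + 2) ^ 2 / ((n : ℝ) + 1))) atTop
      (𝓝 κ⁻¹) := by
  set v : ℕ → ℝ := fun n => 1 / Real.log ((n : ℝ) + 2) ^ 2 with hv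
  have hvt : IsTempered v := isTempered_logWeight
  have hwt := isTempered_succ_inv_mul hvt
  have hb' : Tendsto (fun n : ℕ => ((n : ℝ) + 1) * b n) atTop (𝓝 κ) := by
    have h1 := hb.div (tendsto_natCast_div_add_atTop (1 : ℝ)) one_ne_zero
    rw [div_one] at h1
    refine h1.congr' ?_
    filter_upwards [eventually_gt_atTop 0] with n hn
    have : (n : ℝ) ≠ 0 := by exact_mod_cast hn.ne'
    simp only [Pi.div_apply]
    field_simp
  have hTlog := hK.tendsto_tail_mul_log hκ hb'
  have hT0 : Tendsto (tail b) atTop (𝓝 0) := by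
    have h1 := hTlog.mul tendsto_log_add_two.inv_tendsto_atTop
    rw [mul_zero] at h1
    refine h1.congr fun n => ?_
    simp only [Pi.inv_apply]
    rw [mul_inv_cancel_right₀ (log_add_two_pos n).ne']
  have hT2 : Tendsto (fun n => tail b n ^ 2 / v n) atTop (𝓝 (κ⁻¹ ^ 2)) := by
    refine (hTlog.pow 2).congr fun n => ?_
    simp [hv, mul_pow]
  -- Since `v` is not summable, n b_n is replaced by its differences: they are O(1/n²) and telescope
  -- to the sum κ, while the compensating 1/(1 - X) turns one factor 1 - A into the series of tails.
  set p : ℕ → ℝ := fun n => PowerSeries.coeff n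
    ((1 - PowerSeries.X) * (PowerSeries.X * PowerSeries.derivative ℝ (PowerSeries.mk b))) with hp
  have hp0 : p 0 = 0 := by simp [hp]
  have hps : ∀ n : ℕ, p (n + 1) = ((n : ℝ) + 1) * b (n + 1) - (n : ℝ) * b n := by
    intro n
    simp only [hp]
    rw [sub_mul, one_mul, map_sub, coeff_X_mul_derivative, PowerSeries.coeff_succ_X_mul,
      coeff_X_mul_derivative]
    simp
  have hpnn : ∀ n, 0 ≤ p n := by
    rintro (_ | n)
    · exact hp0.ge
    · rw [hps]; exact sub_nonneg.2 (hmono n)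
  have hM0 : 0 ≤ M := by
    have h1 := (sub_nonneg.2 (hmono 0)).trans (hM 0)
    norm_num at h1
    linarith
  have hpM : ∀ n : ℕ, |p n| ≤ M / ((n : ℝ) + 1) ^ 2 := by
    rintro (_ | n)
    · rw [hp0, abs_zero]; positivity
    · rw [abs_of_nonneg (hpnn _), hps]
      refine (hM n).trans (le_of_eq ?_)
      push_cast
      ring
  have hpsum : ∀ n : ℕ, ∑ k ∈ Finset.range (n + 1), p k = n * b n := by
    intro n
    induction n with
    | zero => simp [hp0]
    | succ n ih => rw [Finset.sum_range_succ, ih, hps]; push_cast; ring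
  have hptsum : ∑' n, p n = κ := by
    refine HasSum.tsum_eq ((hasSum_iff_tendsto_nat_of_nonneg hpnn κ).2 ?_)
    rw [← tendsto_add_atTop_iff_nat 1]
    exact hb.congr fun n => (hpsum n).symm
  set E : ℕ → ℝ := fun n => PowerSeries.coeff n
    ((1 - PowerSeries.mk (recipSeq b)) * PowerSeries.mk (tail b)) with hE
  have hrec : ∀ n : ℕ, (n : ℝ) * recipSeq b n =
      ∑ q ∈ Finset.HasAntidiagonal.antidiagonal n, p q.1 * E q.2 := by
    intro n
    have h1 : PowerSeries.X * PowerSeries.derivative ℝ (PowerSeries.mk (recipSeq b)) =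
        ((1 - PowerSeries.X) * (PowerSeries.X * PowerSeries.derivative ℝ (PowerSeries.mk b))) *
        ((1 - PowerSeries.mk (recipSeq b)) * PowerSeries.mk (tail b)) := by
      rw [derivative_recipSeq hK.zero]
      linear_combination (-PowerSeries.X * PowerSeries.derivative ℝ (PowerSeries.mk b) *
        (1 - PowerSeries.mk (recipSeq b))) * one_sub_X_mul_mk_tail (b := b)
    have h2 := congrArg (PowerSeries.coeff n) h1
    rw [coeff_X_mul_derivative, PowerSeries.coeff_mul, PowerSeries.coeff_mk] at h2
    exact h2
  -- Main term plus error: subtracting `tail b n` inside the convolution uses ∑_{k≤n} a_k = 1 -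
  -- tail_n, which leaves tail_n² ~ κ⁻² v_n.
  have hEeq : ∀ n, E n = tail b n ^ 2 -
      ∑ k ∈ Finset.range (n + 1), recipSeq b k * (tail b (n - k) - tail b n) := by
    intro n
    simp only [hE]
    rw [sub_mul, one_mul, map_sub, PowerSeries.coeff_mul]
    simp only [PowerSeries.coeff_mk]
    rw [Finset.Nat.sum_antidiagonal_eq_sum_range_succ (fun i j => recipSeq b i * tail b j)]
    simp only [mul_sub, Finset.sum_sub_distrib, ← Finset.sum_mul]
    have h1 : ∑ k ∈ Finset.range (n + 1), recipSeq b k = 1 - tail b n := by simp [tail]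
    rw [h1]
    ring
  have hElet : ∀ n, E n ≤ tail b n ^ 2 := by
    intro n
    rw [hEeq]
    have : 0 ≤ ∑ k ∈ Finset.range (n + 1), recipSeq b k * (tail b (n - k) - tail b n) :=
      Finset.sum_nonneg fun k _ => mul_nonneg (hK.recip_nonneg k)
        (sub_nonneg.2 (hK.tail_antitone (Nat.sub_le _ _)))
    linarith
  -- An a priori bound comes first: E_n ≤ tail_n² and p ≥ 0 give n a_n = O(v_n), which is then used
  -- to show that the error in E_n is o(v_n).
  obtain ⟨Q, hQ0, hQ⟩ : DominatedBy (recipSeq b) (fun n => v n / ((n : ℝ) + 1)) := by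
    obtain ⟨Q, hQ0, hQ⟩ := dominatedBy_of_tendsto hvt.pos
      (tendsto_convolution_of_quadratic_decay hvt hpM tendsto_logWeight
        tendsto_succ_mul_logWeight hT2)
    refine ⟨2 * Q, by positivity, fun n => ?_⟩
    rw [abs_of_nonneg (hK.recip_nonneg n)]
    have hvn := hvt.pos n
    rcases Nat.eq_zero_or_pos n with rfl | hn
    · rw [recipSeq_zero hK.zero]; positivity
    have hn1 : (1 : ℝ) ≤ n := by exact_mod_cast hn
    have h1 : (n : ℝ) * recipSeq b n ≤ Q * v n := by
      rw [hrec n]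
      refine (Finset.sum_le_sum fun q _ => ?_).trans ((le_abs_self _).trans (hQ n))
      exact mul_le_mul_of_nonneg_left (hElet q.2) (hpnn q.1)
    rw [← mul_div_assoc, le_div_iff₀ (by positivity)]
    have := mul_le_mul_of_nonneg_right hn1 (hK.recip_nonneg n)
    linarith
  have ha0 : Tendsto (fun n : ℕ => (n : ℝ) * recipSeq b n) atTop (𝓝 0) := by
    have h1 := tendsto_logWeight.const_mul Q
    rw [mul_zero] at h1
    refine squeeze_zero (fun n => mul_nonneg n.cast_nonneg (hK.recip_nonneg n)) (fun n => ?_) h1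
    have h2 := hQ n
    rw [abs_of_nonneg (hK.recip_nonneg n), ← mul_div_assoc, le_div_iff₀ (by positivity)] at h2
    have := hK.recip_nonneg n
    simp only [hv] at h2
    linarith
  have hR : Tendsto (fun n => (∑ k ∈ Finset.range (n + 1),
      recipSeq b k * (tail b (n - k) - tail b n)) / v n) atTop (𝓝 0) := by
    obtain ⟨K, hK0, hKd⟩ := hwt.doubling
    have h1 := ((tendsto_cesaro_zero ha0).add (tendsto_cesaro_zero hT0)).const_mul (Q * K)
    rw [add_zero, mul_zero] at h1
    refine squeeze_zero (fun n => div_nonneg (Finset.sum_nonneg fun k _ =>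
      mul_nonneg (hK.recip_nonneg k) (sub_nonneg.2 (hK.tail_antitone (Nat.sub_le _ _))))
        (hvt.pos n).le) (fun n => ?_) h1
    have hvn := hvt.pos n
    have hbig : ∀ j, n ≤ 2 * j → j ≤ n → recipSeq b j ≤ Q * (K * (v n / ((n : ℝ) + 1))) := by
      intro j h1 h2
      refine ((le_abs_self _).trans (hQ j)).trans (mul_le_mul_of_nonneg_left (hKd n j h1 h2) hQ0)
    have hterm : ∀ k ∈ Finset.range (n + 1), recipSeq b k * (tail b (n - k) - tail b n) ≤
        Q * (K * (v n / ((n : ℝ) + 1))) * (|(k : ℝ) * recipSeq b k| + |tail b (n - k)|) := by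
      intro k hk
      have hk' := Finset.mem_range.1 hk
      have hak := hK.recip_nonneg k
      rw [abs_of_nonneg (mul_nonneg k.cast_nonneg hak), abs_of_nonneg (hK.tail_nonneg _)]
      have hc : 0 ≤ Q * (K * (v n / ((n : ℝ) + 1))) := by positivity
      -- For k ≤ n/2 the difference of tails is a sum of k terms a_j with j > n/2, each
      -- O(v_n/(n+1)); for k > n/2 it is a_k itself that has this size.
      rcases le_or_gt (2 * k) n with h2 | h2
      · have h3 : tail b (n - k) - tail b n ≤ k * (Q * (K * (v n / ((n : ℝ) + 1)))) := by
          have h4 : tail b (n - k) - tail b n =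
              ∑ j ∈ Finset.Ico (n - k + 1) (n + 1), recipSeq b j := by
            rw [Finset.sum_Ico_eq_sub _ (by omega)]
            simp [tail]
          rw [h4]
          have h5 := Finset.sum_le_card_nsmul (Finset.Ico (n - k + 1) (n + 1)) (recipSeq b)
            (Q * (K * (v n / ((n : ℝ) + 1)))) (fun j hj => by
              have := Finset.mem_Ico.1 hj
              exact hbig j (by omega) (by omega))
          have h6 : n + 1 - (n - k + 1) = k := by omega
          rwa [Nat.card_Ico, h6, nsmul_eq_mul] at h5
        have h4 := mul_le_mul_of_nonneg_left h3 hak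
        have h5 := mul_nonneg hc (hK.tail_nonneg (n - k))
        linarith
      · have h3 := hbig k (by omega) (by omega)
        have h4 : tail b (n - k) - tail b n ≤ tail b (n - k) := by linarith [hK.tail_nonneg n]
        have h5 := mul_le_mul h3 h4 (sub_nonneg.2 (hK.tail_antitone (Nat.sub_le _ _))) hc
        have h6 := mul_nonneg hc (mul_nonneg (k.cast_nonneg (α := ℝ)) hak)
        linarith
    rw [div_le_iff₀ hvn]
    refine (Finset.sum_le_sum hterm).trans (le_of_eq ?_)
    rw [← Finset.mul_sum, Finset.sum_add_distrib]
    have h2 : ∑ k ∈ Finset.range (n + 1), |tail b (n - k)| =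
        ∑ k ∈ Finset.range (n + 1), |tail b k| := by
      rw [← Finset.sum_range_reflect (fun k => |tail b k|)]
      refine Finset.sum_congr rfl fun k _ => ?_
      simp
    rw [h2]
    field_simp
  have hElim : Tendsto (fun n => E n / v n) atTop (𝓝 (κ⁻¹ ^ 2)) := by
    have h1 := hT2.sub hR
    rw [sub_zero] at h1
    refine h1.congr fun n => ?_
    rw [hEeq, sub_div]
  have h1 := tendsto_convolution_of_quadratic_decay hvt hpM tendsto_logWeight
    tendsto_succ_mul_logWeight hElim
  have h2 := h1.div (tendsto_natCast_div_add_atTop (1 : ℝ)) one_ne_zero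
  rw [hptsum, div_one] at h2
  have h3 : κ⁻¹ ^ 2 * κ = κ⁻¹ := by field_simp
  rw [h3] at h2
  refine h2.congr' ?_
  filter_upwards [eventually_gt_atTop 0] with n hn
  have hn0 : (n : ℝ) ≠ 0 := by exact_mod_cast hn.ne'
  have hvn := hvt.pos n
  change (∑ q ∈ Finset.HasAntidiagonal.antidiagonal n, p q.1 * E q.2) / v n /
    ((n : ℝ) / ((n : ℝ) + 1)) = recipSeq b n / (v n / ((n : ℝ) + 1))
  rw [← hrec n]
  field_simp

/-- The comparison runs backwards: a is summable by Kaluza's theorem, so any weight asymptotic to a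
multiple of it is too. This gives the convergence of ∑ 1/(n log² n). -/
lemma summable_weight (hK : IsKaluzaPair b h L) {w : ℕ → ℝ} (hw : ∀ n, 0 < w n) {α : ℝ}
    (hα : 0 < α) (ha : Tendsto (fun n : ℕ => recipSeq b n / w n) atTop (𝓝 α)) : Summable w := by
  have h1 := ha.inv₀ hα.ne'
  obtain ⟨M, hM⟩ := h1.abs.bddAbove_range
  refine Summable.of_norm_bounded_eventually_nat (hK.summable_recip.mul_left M) ?_
  filter_upwards [ha.eventually (lt_mem_nhds hα)] with n hn
  have h2 := hM ⟨n, rfl⟩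
  have h3 : 0 < recipSeq b n := by
    by_contra h
    exact absurd hn (not_lt.2 (div_nonpos_of_nonpos_of_nonneg (not_lt.1 h) (hw n).le))
  simp only [inv_div, abs_div, abs_of_pos (hw n), abs_of_pos h3] at h2
  rwa [Real.norm_of_nonneg (hw n).le, ← div_le_iff₀ h3]

end IsKaluzaPair

end recipAsymptotics

/-! ### Products of Pochhammer quotients with parameters in (0,1) -/

section parameters

variable {ι : Type*}

/-- `∏ᵢ (xᵢ)ₘ / m!`. -/
def pochSeq (s : Finset ι) (x : ι → ℝ) (m : ℕ) : ℝ :=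
  ∏ i ∈ s, (ascPochhammer ℝ m).eval (x i) / (m.factorial : ℝ)

/-- `∑ᵢ (H(xᵢ, m) - H(1, m))`. -/
def harmSeq (s : Finset ι) (x : ι → ℝ) (m : ℕ) : ℝ :=
  ∑ i ∈ s, (harm (x i) m - harm 1 m)

lemma pochSeq_zero (s : Finset ι) (x : ι → ℝ) : pochSeq s x 0 = 1 := by simp [pochSeq]

lemma pochSeq_succ (s : Finset ι) (x : ι → ℝ) (m : ℕ) :
    pochSeq s x (m + 1) = pochSeq s x m * ∏ i ∈ s, ((x i + m) / ((m : ℝ) + 1)) := by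
  rw [pochSeq, pochSeq, ← Finset.prod_mul_distrib]
  refine Finset.prod_congr rfl fun i _ => ?_
  rw [ascPochhammer_succ_eval, Nat.factorial_succ]
  have : (m.factorial : ℝ) ≠ 0 := Nat.cast_ne_zero.2 m.factorial_ne_zero
  push_cast
  field_simp

lemma harmSeq_zero (s : Finset ι) (x : ι → ℝ) : harmSeq s x 0 = 0 := by simp [harmSeq, harm]

lemma harmSeq_succ (s : Finset ι) (x : ι → ℝ) (m : ℕ) :
    harmSeq s x (m + 1) = harmSeq s x m + ∑ i ∈ s, (1 / (x i + m) - 1 / (1 + (m : ℝ))) := by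
  rw [harmSeq, harmSeq, ← Finset.sum_add_distrib]
  refine Finset.sum_congr rfl fun i _ => ?_
  simp only [harm, Finset.sum_range_succ]
  ring

variable {s : Finset ι} {x : ι → ℝ}

lemma pochSeq_pos (hx : ∀ i ∈ s, 0 < x i) (m : ℕ) : 0 < pochSeq s x m :=
  Finset.prod_pos fun i hi => div_pos (ascPochhammer_pos m _ (hx i hi)) (by positivity)

/-- Consecutive ratios are products of (x_i + m)/(m + 1), which for 0 < x_i < 1 are below 1 and
increase with m; the increments of h are sums of 1/(x_i + m) - 1/(1 + m) > 0. -/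
lemma isKaluzaPair_pochSeq (hs : s.Nonempty) (hx : ∀ i ∈ s, 0 < x i) (hx1 : ∀ i ∈ s, x i < 1)
    {L : ℝ} (hL : Tendsto (harmSeq s x) atTop (𝓝 L)) :
    IsKaluzaPair (pochSeq s x) (harmSeq s x) L where
  zero := pochSeq_zero s x
  pos := pochSeq_pos hx
  anti m := by
    rw [pochSeq_succ]
    refine mul_le_of_le_one_right (pochSeq_pos hx m).le (Finset.prod_le_one (fun i hi => ?_)
      fun i hi => ?_)
    · have := hx i hi; positivity
    · rw [div_le_one (by positivity)]; linarith [hx1 i hi]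
  logConvex m := by
    have h1 : ∀ m, pochSeq s x (m + 1) / pochSeq s x m = ∏ i ∈ s, ((x i + m) / ((m : ℝ) + 1)) := by
      intro m
      rw [pochSeq_succ, mul_div_cancel_left₀ _ (pochSeq_pos hx m).ne']
    rw [h1, h1]
    refine Finset.prod_le_prod (fun i hi => ?_) fun i hi => ?_
    · have := hx i hi; positivity
    · have h2 := hx1 i hi
      rw [div_le_div_iff₀ (by positivity) (by positivity)]
      push_cast
      nlinarith
  h_zero := harmSeq_zero s x
  h_mono := by
    refine strictMono_nat_of_lt_succ fun m => ?_
    rw [harmSeq_succ]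
    refine lt_add_of_pos_right _ (Finset.sum_pos (fun i hi => ?_) hs)
    have h1 := hx i hi
    refine sub_pos.2 (one_div_lt_one_div_of_lt (by positivity) ?_)
    linarith [hx1 i hi]
  h_lim := hL

/-- Gauss's product formula for Γ, with `n` replaced by `n + 1` in the power to avoid the base 0. -/
lemma tendsto_poch {y : ℝ} (hy : 0 < y) :
    Tendsto (fun m : ℕ => (ascPochhammer ℝ m).eval y / (m.factorial : ℝ) * ((m : ℝ) + 1) ^ (1 - y))
      atTop (𝓝 (Real.Gamma y)⁻¹) := by
  have h1 := (Real.GammaSeq_tendsto_Gamma y).inv₀ (Real.Gamma_pos_of_pos hy).ne'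
  have h2 : Tendsto (fun n : ℕ => (n : ℝ) / ((n : ℝ) + 1)) atTop (𝓝 1) :=
    tendsto_natCast_div_add_atTop 1
  have h3 := h2.rpow_const (p := y) (Or.inl one_ne_zero)
  rw [Real.one_rpow] at h3
  have h4 := (tendsto_natCast_div_add_atTop (𝕜 := ℝ) y).div h2 one_ne_zero
  have h5 := (h1.mul h3).mul h4
  rw [div_one, mul_one, mul_one] at h5
  refine h5.congr' ?_
  filter_upwards [eventually_gt_atTop 0] with n hn
  have hn0 : (0 : ℝ) < n := by exact_mod_cast hn
  have hprod : ∏ j ∈ Finset.range (n + 1), (y + (j : ℝ)) =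
      (ascPochhammer ℝ n).eval y * (y + n) := by
    rw [← ascPochhammer_succ_eval]
    induction n + 1 with
    | zero => simp
    | succ k ih => rw [Finset.prod_range_succ, ih, ascPochhammer_succ_eval]
  have hp := ascPochhammer_pos n y hy
  have hfac : (0 : ℝ) < n.factorial := by positivity
  simp only [Real.GammaSeq, Pi.div_apply]
  rw [hprod, Real.div_rpow hn0.le (by positivity), Real.rpow_sub (by positivity), Real.rpow_one]
  have ha : (0 : ℝ) < (n : ℝ) ^ y := by positivity
  have hb : (0 : ℝ) < ((n : ℝ) + 1) ^ y := by positivity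
  have hc : (0 : ℝ) < (n : ℝ) + y := by positivity
  have hd : y + (n : ℝ) = n + y := add_comm _ _
  rw [hd]
  field_simp

lemma tendsto_pochSeq (hx : ∀ i ∈ s, 0 < x i) (hsum : ∑ i ∈ s, x i = (s.card : ℝ) / 2) :
    ∃ κ, 0 < κ ∧ Tendsto (fun m : ℕ => pochSeq s x m / ((m : ℝ) + 1) ^ (-((s.card : ℝ) / 2)))
      atTop (𝓝 κ) := by
  refine ⟨∏ i ∈ s, (Real.Gamma (x i))⁻¹,
    Finset.prod_pos fun i hi => inv_pos.2 (Real.Gamma_pos_of_pos (hx i hi)), ?_⟩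
  refine (tendsto_finsetProd s fun i hi => tendsto_poch (hx i hi)).congr fun m => ?_
  rw [Finset.prod_mul_distrib, Real.rpow_neg (by positivity), div_inv_eq_mul, pochSeq]
  congr 1
  rw [← Real.rpow_sum_of_pos (by positivity), Finset.sum_sub_distrib, hsum]
  congr 1
  simp
  ring

/-- Each increment of h at step m ≥ 1 is at most `s.card` (1/m - 1/(m+1)), so h_n + `s.card`/n
decreases to L. -/
lemma sub_harmSeq_le (hx : ∀ i ∈ s, 0 < x i) {L : ℝ} (hL : Tendsto (harmSeq s x) atTop (𝓝 L))
    {n : ℕ} (hn : 1 ≤ n) : L - harmSeq s x n ≤ s.card / n := by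
  have hmono : Antitone (fun m : ℕ => harmSeq s x (m + 1) + s.card / ((m : ℝ) + 1)) := by
    refine antitone_nat_of_succ_le fun m => ?_
    rw [harmSeq_succ s x (m + 1)]
    have h1 : ∑ i ∈ s, (1 / (x i + (m + 1 : ℕ)) - 1 / (1 + ((m + 1 : ℕ) : ℝ))) ≤
        s.card • (1 / ((m : ℝ) + 1) - 1 / ((m : ℝ) + 2)) := by
      refine Finset.sum_le_card_nsmul _ _ _ fun i hi => ?_
      have h2 := hx i hi
      have h3 : 1 / (x i + (m + 1 : ℕ)) ≤ 1 / ((m : ℝ) + 1) :=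
        one_div_le_one_div_of_le (by positivity) (by push_cast; linarith)
      have h4 : 1 + ((m + 1 : ℕ) : ℝ) = (m : ℝ) + 2 := by push_cast; ring
      rw [h4]
      linarith
    rw [nsmul_eq_mul] at h1
    have h5 : (((m + 1 : ℕ) : ℝ) + 1) = (m : ℝ) + 2 := by push_cast; ring
    rw [h5]
    have h6 : (s.card : ℝ) * (1 / ((m : ℝ) + 1) - 1 / ((m : ℝ) + 2)) =
        s.card / ((m : ℝ) + 1) - s.card / ((m : ℝ) + 2) := by ring
    linarith
  have hlim : Tendsto (fun m : ℕ => harmSeq s x (m + 1) + s.card / ((m : ℝ) + 1)) atTop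
      (𝓝 (L + s.card * 0)) := by
    refine (hL.comp (tendsto_add_atTop_nat 1)).add ?_
    refine (tendsto_one_div_add_atTop_nhds_zero_nat.const_mul (s.card : ℝ)).congr fun n => ?_
    rw [mul_one_div]
  have h1 := hmono.le_of_tendsto hlim (n - 1)
  have h2 : ((n - 1 : ℕ) : ℝ) + 1 = n := by
    rw [← Nat.cast_add_one, Nat.sub_add_cancel hn]
  rw [Nat.sub_add_cancel hn, h2] at h1
  linarith

/-- The coefficients of the exponential when there are at least three parameters. -/
lemma exists_tendsto_exp_rpow (hx : ∀ i ∈ s, 0 < x i) (hx1 : ∀ i ∈ s, x i < 1)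
    (hsum : ∑ i ∈ s, x i = (s.card : ℝ) / 2) (hcard : 3 ≤ s.card) {L : ℝ}
    (hL : Tendsto (harmSeq s x) atTop (𝓝 L)) {e : ℕ → ℝ} (he0 : e 0 = 1)
    (he : ∀ n, 0 ≤ e n) (hes : Summable e)
    (hrec : ∀ n : ℕ, (n : ℝ) * e n = ∑ p ∈ Finset.HasAntidiagonal.antidiagonal n,
      (p.1 * quotSeq (pochSeq s x) (harmSeq s x) p.1) * e p.2) :
    ∃ c, 0 < c ∧
      Tendsto (fun n : ℕ => e n / ((n : ℝ) + 1) ^ (-((s.card : ℝ) / 2))) atTop (𝓝 c) := by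
  have hK := isKaluzaPair_pochSeq (Finset.card_pos.1 (by omega)) hx hx1 hL
  obtain ⟨κ, hκ, hb⟩ := tendsto_pochSeq hx hsum
  have h3 : (3 : ℝ) ≤ s.card := by exact_mod_cast hcard
  have h1 : (1 : ℝ) < (s.card : ℝ) / 2 := by linarith
  have hw := isTempered_rpow (s := (s.card : ℝ) / 2) (by positivity)
  obtain ⟨α, hα, ha⟩ := hK.tendsto_recip_of_summable hw (summable_rpow_weight h1)
    (tendsto_succ_mul_rpow_weight h1) hκ hb
  refine hK.tendsto_exp he0 he hes hrec hw (summable_rpow_weight h1)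
    (tendsto_succ_mul_rpow_weight h1) hα ha ?_
  have h4 := (hL.const_sub L).mul hb
  rw [sub_self, zero_mul] at h4
  exact h4.congr fun n => (mul_div_assoc _ _ _).symm

/-- The coefficients of the exponential when there are two parameters. -/
lemma exists_tendsto_exp_log (hx : ∀ i ∈ s, 0 < x i) (hx1 : ∀ i ∈ s, x i < 1)
    (hsum : ∑ i ∈ s, x i = (s.card : ℝ) / 2) (hcard : s.card = 2) {L : ℝ}
    (hL : Tendsto (harmSeq s x) atTop (𝓝 L)) {e : ℕ → ℝ} (he0 : e 0 = 1)
    (he : ∀ n, 0 ≤ e n) (hes : Summable e)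
    (hrec : ∀ n : ℕ, (n : ℝ) * e n = ∑ p ∈ Finset.HasAntidiagonal.antidiagonal n,
      (p.1 * quotSeq (pochSeq s x) (harmSeq s x) p.1) * e p.2) :
    ∃ c, 0 < c ∧
      Tendsto (fun n : ℕ => e n / (1 / Real.log ((n : ℝ) + 2) ^ 2 / ((n : ℝ) + 1))) atTop
        (𝓝 c) := by
  classical
  have hK := isKaluzaPair_pochSeq (Finset.card_pos.1 (by omega)) hx hx1 hL
  obtain ⟨κ, hκ, hb⟩ := tendsto_pochSeq hx hsum
  have hb1 : Tendsto (fun n : ℕ => ((n : ℝ) + 1) * pochSeq s x n) atTop (𝓝 κ) := by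
    refine hb.congr fun n => ?_
    rw [hcard]
    norm_num [Real.rpow_neg_one]
    ring
  have hb0 : Tendsto (fun n : ℕ => (n : ℝ) * pochSeq s x n) atTop (𝓝 κ) := by
    have h1 := (tendsto_natCast_div_add_atTop (1 : ℝ)).mul hb1
    rw [one_mul] at h1
    refine h1.congr fun n => ?_
    field_simp
  -- The two parameters are x and 1 - x, and (n + x)(n + 1 - x) = n(n + 1) + x(1 - x), so P = x(1 -
  -- x).
  obtain ⟨P, hP0, hPstep⟩ : ∃ P : ℝ, 0 ≤ P ∧ ∀ n : ℕ,
      ((n : ℝ) + 1) * pochSeq s x (n + 1) - n * pochSeq s x n = P * pochSeq s x n / (n + 1) := by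
    obtain ⟨i, j, hij, rfl⟩ := Finset.card_eq_two.1 hcard
    have hi := hx i (by simp)
    have hj := hx j (by simp)
    refine ⟨x i * x j, by positivity, fun n => ?_⟩
    have h1 : x j = 1 - x i := by
      rw [Finset.sum_pair hij, hcard] at hsum
      push_cast at hsum
      linarith
    rw [pochSeq_succ, Finset.prod_pair hij, h1]
    field_simp
    ring
  obtain ⟨M, hM⟩ := hb1.bddAbove_range
  have ha := hK.tendsto_recip_log (M := 4 * (P * M)) hκ hb0
    (fun n => by
      rw [← sub_nonneg, hPstep]
      have := hK.pos n
      positivity)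
    (fun n => by
      rw [hPstep, div_le_div_iff₀ (by positivity) (by positivity)]
      have h1 : ((n : ℝ) + 1) * pochSeq s x n ≤ M := hM ⟨n, rfl⟩
      have h2 := hK.pos n
      have h3 : ((n : ℝ) + 2) ^ 2 ≤ 4 * ((n : ℝ) + 1) ^ 2 := by nlinarith [n.cast_nonneg (α := ℝ)]
      calc P * pochSeq s x n * ((n : ℝ) + 2) ^ 2
          ≤ P * pochSeq s x n * (4 * ((n : ℝ) + 1) ^ 2) :=
            mul_le_mul_of_nonneg_left h3 (by positivity)
        _ = 4 * (P * (((n : ℝ) + 1) * pochSeq s x n)) * ((n : ℝ) + 1) := by ring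
        _ ≤ 4 * (P * M) * ((n : ℝ) + 1) := by gcongr)
  have hw := isTempered_succ_inv_mul isTempered_logWeight
  refine hK.tendsto_exp he0 he hes hrec hw (hK.summable_weight hw.pos (inv_pos.2 hκ) ha)
    ?_ (inv_pos.2 hκ) ha ?_
  · refine tendsto_logWeight.congr fun n => ?_
    field_simp
  · have h1 := (hb1.mul tendsto_log_sq_div).const_mul (2 * (s.card : ℝ))
    rw [mul_zero, mul_zero] at h1
    refine squeeze_zero' (Eventually.of_forall fun n => ?_) ?_ h1
    · exact div_nonneg (mul_nonneg (sub_nonneg.2 (hK.h_le n)) (hK.pos n).le) (hw.pos n).le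
    · filter_upwards [eventually_ge_atTop 1] with n hn
      have hn1 : (1 : ℝ) ≤ n := by exact_mod_cast hn
      have h2 : L - harmSeq s x n ≤ 2 * s.card / ((n : ℝ) + 1) := by
        refine (sub_harmSeq_le hx hL hn).trans ?_
        rw [div_le_div_iff₀ (by positivity) (by positivity)]
        nlinarith [s.card.cast_nonneg (α := ℝ)]
      have h3 := log_add_two_pos n
      have h4 := hK.pos n
      calc (L - harmSeq s x n) * pochSeq s x n / (1 / Real.log ((n : ℝ) + 2) ^ 2 / ((n : ℝ) + 1))
          = (L - harmSeq s x n) * (pochSeq s x n * Real.log ((n : ℝ) + 2) ^ 2 * ((n : ℝ) + 1)) := by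
            field_simp
        _ ≤ (2 * s.card / ((n : ℝ) + 1)) *
              (pochSeq s x n * Real.log ((n : ℝ) + 2) ^ 2 * ((n : ℝ) + 1)) :=
            mul_le_mul_of_nonneg_right h2 (by positivity)
        _ = _ := by field_simp

end parameters

/-! ### The limit of the harmonic factors is log C_N -/

section arithmetic

/-- The sum of `1 / n` over the `n ≤ X` divisible by no element of `P`. -/
def sieveSum (P : Finset ℕ) (X : ℕ) : ℝ :=
  ∑ n ∈ (Finset.Icc 1 X).filter (fun n => ∀ p ∈ P, ¬ p ∣ n), 1 / (n : ℝ)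

lemma sum_Icc_one_eq_sum_range (f : ℕ → ℝ) (X : ℕ) :
    ∑ n ∈ Finset.Icc 1 X, f n = ∑ n ∈ Finset.range X, f (n + 1) := by
  induction X with
  | zero => simp
  | succ X ih => rw [Finset.sum_Icc_succ_top (by omega), ih, Finset.sum_range_succ]

lemma sieveSum_empty (X : ℕ) : sieveSum ∅ X = harmonic X := by
  simp [sieveSum, sum_Icc_one_eq_sum_range, harmonic]

/-- One Legendre sieve step: the terms to remove are n = q m, and m is again free of the primes of
`P` because q is a prime outside `P`. -/
lemma sieveSum_insert {P : Finset ℕ} {q : ℕ} (hP : ∀ p ∈ P, p.Prime) (hq : q.Prime) (hqP : q ∉ P)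
    (X : ℕ) : sieveSum (insert q P) X = sieveSum P X - 1 / q * sieveSum P (X / q) := by
  have h1 : sieveSum P X = sieveSum (insert q P) X +
      ∑ n ∈ (Finset.Icc 1 X).filter (fun n => (∀ p ∈ P, ¬ p ∣ n) ∧ q ∣ n), 1 / (n : ℝ) := by
    rw [sieveSum, sieveSum, ← Finset.sum_filter_add_sum_filter_not _ (fun n => ¬ q ∣ n),
      Finset.filter_filter, Finset.filter_filter]
    congr 1
    · refine Finset.sum_congr (Finset.filter_congr fun n _ => ?_) fun _ _ => rfl
      simp [and_comm]
    · simp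
  have h2 : ∑ n ∈ (Finset.Icc 1 X).filter (fun n => (∀ p ∈ P, ¬ p ∣ n) ∧ q ∣ n), 1 / (n : ℝ) =
      1 / q * sieveSum P (X / q) := by
    rw [sieveSum, Finset.mul_sum]
    refine Finset.sum_nbij' (fun n => n / q) (fun m => q * m) ?_ ?_ ?_ ?_ ?_
    · intro n hn
      simp only [Finset.mem_filter, Finset.mem_Icc] at hn ⊢
      obtain ⟨⟨hn1, hnX⟩, hnP, m, rfl⟩ := hn
      rw [Nat.mul_div_cancel_left _ hq.pos]
      refine ⟨⟨?_, (Nat.le_div_iff_mul_le hq.pos).2 (by linarith)⟩,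
        fun p hp hpm => hnP p hp (hpm.mul_left q)⟩
      exact Nat.pos_of_ne_zero fun h => by simp [h] at hn1
    · intro m hm
      simp only [Finset.mem_filter, Finset.mem_Icc] at hm ⊢
      obtain ⟨⟨hm1, hmX⟩, hmP⟩ := hm
      refine ⟨⟨Nat.mul_pos hq.pos hm1, ?_⟩, fun p hp hpm => ?_, dvd_mul_right q m⟩
      · have := (Nat.le_div_iff_mul_le hq.pos).1 hmX
        linarith
      · rcases (hP p hp).dvd_mul.1 hpm with h | h
        · exact hqP ((Nat.prime_dvd_prime_iff_eq (hP p hp) hq).1 h ▸ hp)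
        · exact hmP p hp h
    · intro n hn
      exact Nat.mul_div_cancel' (Finset.mem_filter.1 hn).2.2
    · intro m _
      exact Nat.mul_div_cancel_left _ hq.pos
    · intro n hn
      obtain ⟨m, rfl⟩ := (Finset.mem_filter.1 hn).2.2
      rw [Nat.mul_div_cancel_left _ hq.pos]
      push_cast
      rw [one_div_mul_one_div]
  rw [← h2]
  linarith

lemma tendsto_log_div {q : ℕ} (hq : 0 < q) :
    Tendsto (fun X : ℕ => Real.log ((X / q : ℕ) : ℝ) - Real.log X) atTop (𝓝 (-Real.log q)) := by
  have h1 := (tendsto_nat_floor_mul_div_atTop (R := ℝ) (a := 1 / q) (by positivity)).comp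
    tendsto_natCast_atTop_atTop
  have hq0 : (1 / (q : ℝ)) ≠ 0 := by positivity
  have h2 := h1.log hq0
  rw [one_div, Real.log_inv] at h2
  refine h2.congr' ?_
  filter_upwards [eventually_ge_atTop q] with X hX
  have h3 : ⌊(q : ℝ)⁻¹ * (X : ℝ)⌋₊ = X / q := by
    rw [mul_comm, ← div_eq_mul_inv, Nat.floor_div_eq_div]
  have h4 : (0 : ℝ) < (X / q : ℕ) := by exact_mod_cast Nat.div_pos hX hq
  have h5 : (0 : ℝ) < X := by exact_mod_cast hq.trans_le hX
  simp only [Function.comp]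
  rw [h3, Real.log_div h4.ne' h5.ne']

/-- Induction on `P` from the definition of Euler's constant: sieving by q multiplies the density by
1 - 1/q, and the shift log(X/q) = log X - log q + o(1) adds log q/(q - 1) to the constant. -/
lemma tendsto_sieveSum {P : Finset ℕ} (hP : ∀ p ∈ P, p.Prime) :
    Tendsto (fun X : ℕ => sieveSum P X - (∏ p ∈ P, (1 - (p : ℝ)⁻¹)) * Real.log X) atTop
      (𝓝 ((∏ p ∈ P, (1 - (p : ℝ)⁻¹)) * (Real.eulerMascheroniConstant +
        ∑ p ∈ P, Real.log p / ((p : ℝ) - 1)))) := by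
  induction P using Finset.induction_on with
  | empty =>
    simp only [Finset.prod_empty, Finset.sum_empty, one_mul, add_zero, sieveSum_empty]
    exact Real.tendsto_harmonic_sub_log
  | insert q P hqP ih =>
    have hq : q.Prime := hP q (Finset.mem_insert_self _ _)
    have hP' : ∀ p ∈ P, p.Prime := fun p hp => hP p (Finset.mem_insert_of_mem hp)
    have h0 := ih hP'
    rw [Finset.prod_insert hqP, Finset.sum_insert hqP]
    set α := ∏ p ∈ P, (1 - (p : ℝ)⁻¹)
    set σ := ∑ p ∈ P, Real.log p / ((p : ℝ) - 1)
    have hdiv : Tendsto (fun X : ℕ => X / q) atTop atTop := Nat.tendsto_div_const_atTop hq.ne_zero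
    have h1 := (h0.comp hdiv).add ((tendsto_log_div hq.pos).const_mul α)
    have h2 := h0.sub (h1.const_mul (1 / (q : ℝ)))
    have hq1 : (1 : ℝ) < q := by exact_mod_cast hq.one_lt
    have hq2 : (q : ℝ) - 1 ≠ 0 := by linarith
    have hq0 : (q : ℝ) ≠ 0 := by linarith
    convert h2 using 1
    · funext X
      rw [sieveSum_insert hP' hq hqP]
      simp only [Function.comp]
      ring
    · congr 1
      field_simp
      ring

lemma coprime_iff_forall_primeFactors {n N : ℕ} (hN : N ≠ 0) :
    Nat.Coprime n N ↔ ∀ p ∈ N.primeFactors, ¬ p ∣ n := by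
  constructor
  · intro h p hp hpn
    exact Nat.not_coprime_of_dvd_of_dvd (Nat.prime_of_mem_primeFactors hp).one_lt hpn
      (Nat.dvd_of_mem_primeFactors hp) h
  · intro h
    by_contra hc
    obtain ⟨p, hp, hpd⟩ := Nat.exists_prime_and_dvd hc
    exact h p (Nat.mem_primeFactors.2 ⟨hp, hpd.trans (Nat.gcd_dvd_right _ _), hN⟩)
      (hpd.trans (Nat.gcd_dvd_left _ _))

/-- The numbers r + iN with r a residue and i < m are exactly the integers up to mN coprime to N. -/
lemma sum_harm_residues {N : ℕ} (hN : N ≠ 0) (m : ℕ) :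
    ∑ r ∈ residues N, harm ((r : ℝ) / N) m = N * sieveSum N.primeFactors (m * N) := by
  have hN0 : (N : ℝ) ≠ 0 := by exact_mod_cast hN
  induction m with
  | zero => simp [harm, sieveSum]
  | succ m ih =>
    have h1 : sieveSum N.primeFactors ((m + 1) * N) = sieveSum N.primeFactors (m * N) +
        ∑ r ∈ residues N, 1 / ((r : ℝ) + m * N) := by
      simp only [sieveSum, residues, Finset.sum_filter, ← coprime_iff_forall_primeFactors hN]
      rw [sum_Icc_one_eq_sum_range, sum_Icc_one_eq_sum_range, sum_Icc_one_eq_sum_range,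
        add_mul, one_mul, Finset.sum_range_add]
      congr 1
      refine Finset.sum_congr rfl fun n _ => ?_
      have h2 : Nat.Coprime (m * N + n + 1) N ↔ Nat.Coprime (n + 1) N := by
        rw [add_assoc]; simp
      simp only [h2]
      push_cast
      congr 2
      ring
    have h3 : ∀ r : ℕ, harm ((r : ℝ) / N) (m + 1) =
        harm ((r : ℝ) / N) m + N * (1 / ((r : ℝ) + m * N)) := by
      intro r
      rw [harm, harm, Finset.sum_range_succ]
      congr 1
      have h4 : (r : ℝ) / N + m = (r + m * N) / N := by field_simp
      rw [h4, one_div_div, mul_one_div]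
    simp only [h3, Finset.sum_add_distrib, ih, h1, ← Finset.mul_sum]
    ring

lemma log_C1 {N : ℕ} (hN : N ≠ 0) :
    Real.log (C1 N) = N.totient * (Real.log N +
      ∑ p ∈ N.primeFactors, Real.log p / ((p : ℝ) - 1)) := by
  have hprod : (∏ p ∈ N.primeFactors, p ^ (N.totient / (p - 1)) : ℕ) ≠ 0 :=
    Finset.prod_ne_zero_iff.2 fun p hp =>
      pow_ne_zero _ (Nat.prime_of_mem_primeFactors hp).ne_zero
  rw [C1, Nat.cast_mul, Real.log_mul (by exact_mod_cast pow_ne_zero _ hN) (by exact_mod_cast hprod),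
    Nat.cast_pow, Real.log_pow, mul_add, Nat.cast_prod, Real.log_prod, Finset.mul_sum]
  · congr 1
    refine Finset.sum_congr rfl fun p hp => ?_
    have hp' := Nat.prime_of_mem_primeFactors hp
    have h1 : p - 1 ∣ N.totient := by
      rw [← Nat.totient_prime hp']
      exact Nat.totient_dvd_of_dvd (Nat.dvd_of_mem_primeFactors hp)
    have h2 : ((p - 1 : ℕ) : ℝ) = p - 1 := by rw [Nat.cast_sub hp'.one_le, Nat.cast_one]
    have h3 : ((p : ℝ) - 1) ≠ 0 := by
      have : (1 : ℝ) < p := by exact_mod_cast hp'.one_lt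
      linarith
    rw [Nat.cast_pow, Real.log_pow, Nat.cast_div h1 (by rwa [h2]), h2]
    ring
  · intro p hp
    exact_mod_cast pow_ne_zero _ (Nat.prime_of_mem_primeFactors hp).ne_zero

/-- Since N ∏ (1 - 1/p) = φ(N), Euler's constant and log m cancel against φ(N) H(1, m); what remains
is φ(N) (log N + ∑ log p/(p - 1)). -/
lemma tendsto_H1 {N : ℕ} (hN : N ≠ 0) : Tendsto (H1 N) atTop (𝓝 (Real.log (C1 N))) := by
  have hN0 : (N : ℝ) ≠ 0 := by exact_mod_cast hN
  have hphi : (N : ℝ) * ∏ p ∈ N.primeFactors, (1 - (p : ℝ)⁻¹) = N.totient := by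
    have := Nat.totient_eq_mul_prod_factors N
    have h2 := congrArg (fun q : ℚ => (q : ℝ)) this
    push_cast at h2
    exact h2.symm
  have h1 := ((tendsto_sieveSum (P := N.primeFactors)
    fun p hp => Nat.prime_of_mem_primeFactors hp).comp
      (tendsto_id.atTop_mul_const' (Nat.pos_of_ne_zero hN))).const_mul (N : ℝ)
  have h2 := (h1.sub (Real.tendsto_harmonic_sub_log.const_mul (N.totient : ℝ))).add_const
    (N.totient * Real.log N)
  rw [log_C1 hN]
  have h3 : ∀ x y : ℝ, (N : ℝ) * ((∏ p ∈ N.primeFactors, (1 - (p : ℝ)⁻¹)) * (x + y)) -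
      N.totient * x + N.totient * Real.log N = N.totient * (Real.log N + y) := by
    intro x y
    rw [← mul_assoc, hphi]
    ring
  rw [h3] at h2
  refine h2.congr' ?_
  filter_upwards [eventually_gt_atTop 0] with m hm
  have hm0 : (m : ℝ) ≠ 0 := by exact_mod_cast hm.ne'
  have h4 : harm 1 m = harmonic m := by
    simp [harm, harmonic, add_comm]
  simp only [Function.comp, id]
  rw [H1, sum_harm_residues hN, h4, mul_sub, ← mul_assoc, hphi]
  push_cast
  rw [Real.log_mul hm0 hN0]
  ring

lemma card_residues {N : ℕ} (hN : 2 ≤ N) : (residues N).card = N.totient := by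
  rw [Nat.totient_eq_card_coprime]
  congr 1
  ext r
  simp only [residues, Finset.mem_filter, Finset.mem_Icc, Finset.mem_range]
  constructor
  · rintro ⟨⟨h1, h2⟩, h3⟩
    refine ⟨lt_of_le_of_ne h2 ?_, h3.symm⟩
    rintro rfl
    rw [Nat.coprime_self] at h3
    omega
  · rintro ⟨h1, h2⟩
    refine ⟨⟨Nat.pos_of_ne_zero ?_, h1.le⟩, h2.symm⟩
    rintro rfl
    rw [Nat.coprime_zero_right] at h2
    omega

lemma residues_pos_lt {N r : ℕ} (hN : 2 ≤ N) (hr : r ∈ residues N) : 0 < r ∧ r < N := by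
  simp only [residues, Finset.mem_filter, Finset.mem_Icc] at hr
  refine ⟨hr.1.1, lt_of_le_of_ne hr.1.2 ?_⟩
  rintro rfl
  rw [Nat.coprime_self] at hr
  omega

/-- The involution r ↦ N - r pairs each fraction with its complement to 1. -/
lemma sum_residues {N : ℕ} (hN : 2 ≤ N) :
    ∑ r ∈ residues N, (r : ℝ) / N = (N.totient : ℝ) / 2 := by
  have hN0 : (N : ℝ) ≠ 0 := by positivity
  have hmaps : ∀ r ∈ residues N, N - r ∈ residues N := by
    intro r hr
    have h1 := residues_pos_lt hN hr
    simp only [residues, Finset.mem_filter, Finset.mem_Icc] at hr ⊢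
    refine ⟨⟨by omega, by omega⟩, ?_⟩
    exact (Nat.coprime_self_sub_left h1.2.le).2 hr.2
  have h1 : ∑ r ∈ residues N, (r : ℝ) / N = ∑ r ∈ residues N, (1 - (r : ℝ) / N) := by
    refine Finset.sum_nbij' (fun r => N - r) (fun r => N - r) hmaps hmaps ?_ ?_ ?_
    · intro r hr
      have := residues_pos_lt hN hr
      omega
    · intro r hr
      have := residues_pos_lt hN hr
      omega
    · intro r hr
      have := residues_pos_lt hN hr
      rw [Nat.cast_sub this.2.le]
      field_simp
      ring
  rw [Finset.sum_sub_distrib] at h1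
  simp only [Finset.sum_const, card_residues hN, nsmul_eq_mul, mul_one] at h1
  linarith

end arithmetic

/-! ### The case of the single parameter 1/2 -/

section catalanCase

lemma eq_of_log_derivative_recurrence {g e f : ℕ → ℝ} (h0 : e 0 = f 0)
    (he : ∀ n : ℕ, (n : ℝ) * e n =
      ∑ p ∈ Finset.HasAntidiagonal.antidiagonal n, (p.1 * g p.1) * e p.2)
    (hf : ∀ n : ℕ, (n : ℝ) * f n =
      ∑ p ∈ Finset.HasAntidiagonal.antidiagonal n, (p.1 * g p.1) * f p.2) (n : ℕ) : e n = f n := by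
  induction n using Nat.strong_induction_on with
  | _ n ih =>
    rcases Nat.eq_zero_or_pos n with rfl | hn
    · exact h0
    have hn0 : (n : ℝ) ≠ 0 := by exact_mod_cast hn.ne'
    refine mul_left_cancel₀ hn0 ?_
    rw [he, hf]
    refine Finset.sum_congr rfl fun p hp => ?_
    rcases Nat.eq_zero_or_pos p.1 with h1 | h1
    · simp [h1]
    · rw [ih p.2 (by have := Finset.HasAntidiagonal.mem_antidiagonal.1 hp; omega)]

/-- The generating function of the Catalan numbers, rescaled to have radius of convergence `1`. -/
def catalanSeries : PowerSeries ℝ := PowerSeries.mk fun n => (catalan n : ℝ) / 4 ^ n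

lemma coeff_catalanSeries_sq (n : ℕ) :
    PowerSeries.coeff n (catalanSeries * catalanSeries) = (catalan (n + 1) : ℝ) / 4 ^ n := by
  rw [PowerSeries.coeff_mul, catalan_succ', Nat.cast_sum, Finset.sum_div]
  refine Finset.sum_congr rfl fun p hp => ?_
  rw [← Finset.HasAntidiagonal.mem_antidiagonal.1 hp, pow_add]
  simp only [catalanSeries, PowerSeries.coeff_mk]
  push_cast
  field_simp

lemma catalanSeries_eq :
    4 * (catalanSeries - 1) = PowerSeries.X * (catalanSeries * catalanSeries) := by
  have h4 : (4 : PowerSeries ℝ) = PowerSeries.C (4 : ℝ) := (map_ofNat PowerSeries.C 4).symm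
  ext n
  rw [h4, PowerSeries.coeff_C_mul]
  rcases n with _ | n
  · simp [catalanSeries]
  · rw [PowerSeries.coeff_succ_X_mul, coeff_catalanSeries_sq, map_sub, PowerSeries.coeff_one]
    simp only [catalanSeries, PowerSeries.coeff_mk, Nat.add_eq_zero_iff, one_ne_zero, and_false,
      if_false, sub_zero, pow_succ]
    field_simp

variable {b h e : ℕ → ℝ}

lemma eq_centralBinom (hb0 : b 0 = 1)
    (hb : ∀ n : ℕ, b (n + 1) = b n * ((1 / 2 + n) / ((n : ℝ) + 1))) (n : ℕ) :
    b n = (n.centralBinom : ℝ) / 4 ^ n := by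
  induction n with
  | zero => simp [hb0]
  | succ n ih =>
    have h1 := Nat.succ_mul_centralBinom_succ n
    have h2 : ((n : ℝ) + 1) * ((n + 1).centralBinom : ℝ) =
        2 * (2 * n + 1) * (n.centralBinom : ℝ) := by exact_mod_cast h1
    rw [hb, ih, pow_succ]
    field_simp
    linarith

/-- Write c for the rescaled Catalan series. Then f = (c X)' = (1 - X)^(-1/2) as series, and
first-order equations for f and the numerator lead to 2 g' = c f and 4 c' = f c². Thus c² and exp g
have the same logarithmic derivative and the same constant term, and the coefficients of c² are
shifted Catalan numbers. -/
lemma eq_catalan_of_half (hb0 : b 0 = 1)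
    (hb : ∀ n : ℕ, b (n + 1) = b n * ((1 / 2 + n) / ((n : ℝ) + 1)))
    (hh : ∀ n : ℕ, h (n + 1) = h n + (1 / (1 / 2 + (n : ℝ)) - 1 / (1 + (n : ℝ))))
    (he0 : e 0 = 1)
    (hrec : ∀ n : ℕ, (n : ℝ) * e n =
      ∑ p ∈ Finset.HasAntidiagonal.antidiagonal n, (p.1 * quotSeq b h p.1) * e p.2) (n : ℕ) :
    e n = (catalan (n + 1) : ℝ) / 4 ^ n := by
  set c := catalanSeries with hc
  set f := PowerSeries.mk b with hf
  set Gs := PowerSeries.mk (fun n => h n * b n) with hGs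
  set g := PowerSeries.mk (quotSeq b h) with hg
  have h2 : (2 : PowerSeries ℝ) = PowerSeries.C (2 : ℝ) := (map_ofNat PowerSeries.C 2).symm
  have hgf : g * f = Gs := by
    have h3 := mk_mul_one_sub_recipSeq hb0
    rw [hg, mk_quotSeq]
    linear_combination Gs * h3
  have hcat : ∀ n : ℕ, ((n : ℝ) + 1) * ((catalan n : ℝ) / 4 ^ n) = b n := by
    intro n
    have h1 : ((n : ℝ) + 1) * (catalan n : ℝ) = (n.centralBinom : ℝ) := by
      exact_mod_cast succ_mul_catalan_eq_centralBinom n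
    rw [eq_centralBinom hb0 hb, ← h1, mul_div_assoc]
  have E1 := catalanSeries_eq
  have E1' := congrArg (PowerSeries.derivative ℝ) E1
  have h4 : (4 : PowerSeries ℝ) = PowerSeries.C (4 : ℝ) := (map_ofNat PowerSeries.C 4).symm
  have hd4 : PowerSeries.derivative ℝ (4 : PowerSeries ℝ) = 0 := by
    rw [h4, PowerSeries.derivative_C]
  simp only [Derivation.leibniz, smul_eq_mul, map_sub, Derivation.map_one_eq_zero,
    PowerSeries.derivative_X, hd4] at E1'
  have E2 : f = c + PowerSeries.X * PowerSeries.derivative ℝ c := by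
    ext n
    rw [map_add, coeff_X_mul_derivative, hf, PowerSeries.coeff_mk, ← hcat n, hc, catalanSeries,
      PowerSeries.coeff_mk]
    ring
  have Ef : 2 * ((1 - PowerSeries.X) * PowerSeries.derivative ℝ f) = f := by
    ext n
    rw [h2, PowerSeries.coeff_C_mul, sub_mul, one_mul, map_sub, coeff_X_mul_derivative,
      PowerSeries.coeff_derivative, hf, PowerSeries.coeff_mk, PowerSeries.coeff_mk, hb]
    field_simp
    ring
  have EG : 2 * ((1 - PowerSeries.X) * PowerSeries.derivative ℝ Gs) = Gs + c := by
    ext n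
    have h5 : (catalan n : ℝ) / 4 ^ n = b n / ((n : ℝ) + 1) := by
      rw [← hcat n]; field_simp
    rw [h2, PowerSeries.coeff_C_mul, sub_mul, one_mul, map_sub, coeff_X_mul_derivative,
      PowerSeries.coeff_derivative, map_add, hGs, hc, catalanSeries, PowerSeries.coeff_mk,
      PowerSeries.coeff_mk, PowerSeries.coeff_mk, hb, hh, h5]
    field_simp
    ring
  have hdG := congrArg (PowerSeries.derivative ℝ) hgf
  simp only [Derivation.leibniz, smul_eq_mul] at hdG
  -- Differentiating g f = G and inserting the equations `Ef` and `EG` cancels every term containing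
  -- g or G.
  have E3 : 2 * ((1 - PowerSeries.X) * f * PowerSeries.derivative ℝ g) = c := by
    linear_combination 2 * (1 - PowerSeries.X) * hdG + EG - g * Ef - hgf
  have E4 : f * (2 - PowerSeries.X * c) = 2 := by
    have h5 : 2 * (f * (2 - PowerSeries.X * c)) = 2 * 2 := by
      linear_combination 2 * (2 - PowerSeries.X * c) * E2 + PowerSeries.X * E1' + E1
    refine mul_left_cancel₀ (fun h0 => ?_) h5
    have := congrArg (PowerSeries.coeff 0) h0
    rw [h2] at this
    simp at this
  have hne4 : (4 : PowerSeries ℝ) ≠ 0 := fun h0 => by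
    have := congrArg (PowerSeries.coeff 0) h0
    rw [h4] at this
    simp at this
  have E5 : f * f * (1 - PowerSeries.X) = 1 := by
    refine mul_left_cancel₀ hne4 ?_
    linear_combination (f * (2 - PowerSeries.X * c) + 2) * E4 +
      f * f * PowerSeries.X * E1
  have E6 : 4 * PowerSeries.derivative ℝ c = f * (c * c) := by
    linear_combination f * E1' - 2 * PowerSeries.derivative ℝ c * E4
  have E7 : 2 * PowerSeries.derivative ℝ g = c * f := by
    linear_combination f * E3 - 2 * PowerSeries.derivative ℝ g * E5
  have E8 : PowerSeries.derivative ℝ (c * c) = PowerSeries.derivative ℝ g * (c * c) := by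
    rw [Derivation.leibniz]
    simp only [smul_eq_mul]
    refine mul_left_cancel₀ hne4 ?_
    linear_combination 2 * c * E6 - 2 * c * c * E7
  rw [← coeff_catalanSeries_sq]
  refine eq_of_log_derivative_recurrence (f := fun n => PowerSeries.coeff n (c * c)) ?_ hrec ?_ n
  · simp [he0, hc, catalanSeries]
  · intro n
    rw [← coeff_X_mul_derivative, E8, ← mul_assoc, PowerSeries.coeff_mul]
    refine Finset.sum_congr rfl fun p _ => ?_
    rw [coeff_X_mul_derivative, hg, PowerSeries.coeff_mk]

lemma tendsto_catalan :
    Tendsto (fun n : ℕ => (catalan (n + 1) : ℝ) / 4 ^ n / ((n : ℝ) + 1) ^ (-(3 / 2 : ℝ))) atTop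
      (𝓝 (4 / √Real.pi)) := by
  have h1 := (tendsto_poch (y := 1 / 2) (by norm_num)).comp (tendsto_add_atTop_nat 1)
  rw [Real.Gamma_one_half_eq] at h1
  have h2 : Tendsto (fun n : ℕ => (((n + 1 : ℕ) : ℝ)) / (((n + 1 : ℕ) : ℝ) + 1)) atTop (𝓝 1) :=
    (tendsto_natCast_div_add_atTop (1 : ℝ)).comp (tendsto_add_atTop_nat 1)
  have h3 := h2.rpow_const (p := 3 / 2) (Or.inl one_ne_zero)
  rw [Real.one_rpow] at h3
  have h4 := (h1.mul h3).const_mul 4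
  rw [mul_one, ← div_eq_mul_inv] at h4
  refine h4.congr fun n => ?_
  have hb : ∀ n : ℕ, (ascPochhammer ℝ n).eval (1 / 2) / (n.factorial : ℝ) =
      (n.centralBinom : ℝ) / 4 ^ n := by
    refine eq_centralBinom (by simp) fun n => ?_
    rw [ascPochhammer_succ_eval, Nat.factorial_succ]
    have : (n.factorial : ℝ) ≠ 0 := Nat.cast_ne_zero.2 n.factorial_ne_zero
    push_cast
    field_simp
  have hcat : ((n + 1 : ℕ) + 1 : ℝ) * (catalan (n + 1) : ℝ) = ((n + 1).centralBinom : ℝ) := by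
    exact_mod_cast succ_mul_catalan_eq_centralBinom (n + 1)
  simp only [Function.comp]
  rw [hb, ← hcat, Real.rpow_neg (by positivity), Real.div_rpow (by positivity) (by positivity)]
  have h5 : (0 : ℝ) < ((n + 1 : ℕ) : ℝ) + 1 := by positivity
  have h6 : (((n + 1 : ℕ) : ℝ) + 1) ^ (3 / 2 : ℝ) =
      (((n + 1 : ℕ) : ℝ) + 1) * (((n + 1 : ℕ) : ℝ) + 1) ^ (1 - 1 / 2 : ℝ) := by
    rw [← Real.rpow_one_add' h5.le (by norm_num)]
    norm_num
  rw [h6]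
  have h7 : (0 : ℝ) < (((n + 1 : ℕ) : ℝ) + 1) ^ (1 - 1 / 2 : ℝ) := by positivity
  rw [pow_succ]
  generalize (((n + 1 : ℕ) : ℝ) + 1) ^ (1 - 1 / 2 : ℝ) = t at h7 ⊢
  push_cast
  have h8 : (0 : ℝ) < ((n : ℝ) + 1) ^ (3 / 2 : ℝ) := by positivity
  generalize ((n : ℝ) + 1) ^ (3 / 2 : ℝ) = u at h8 ⊢
  field_simp

end catalanCase

/-! ### From the normalised series back to q -/

section assembly

variable {k : ℕ} {N : Fin k → ℕ}

/-- The index set of the parameters `r / N j`. -/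
def paramSet (N : Fin k → ℕ) : Finset (Σ _ : Fin k, ℕ) :=
  Finset.univ.sigma fun j => residues (N j)

/-- The parameters `r / N j`. -/
def param (N : Fin k → ℕ) (i : Σ _ : Fin k, ℕ) : ℝ := (i.2 : ℝ) / (N i.1 : ℝ)

lemma card_paramSet (hN : ∀ j, 2 ≤ N j) : (paramSet N).card = Phi N := by
  rw [paramSet, Finset.card_sigma, Phi]
  exact Finset.sum_congr rfl fun j _ => card_residues (hN j)

lemma sum_param (hN : ∀ j, 2 ≤ N j) :
    ∑ i ∈ paramSet N, param N i = ((paramSet N).card : ℝ) / 2 := by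
  rw [card_paramSet hN, paramSet, Finset.sum_sigma, Phi]
  simp only [param]
  rw [Finset.sum_congr rfl fun j _ => sum_residues (hN j), ← Finset.sum_div]
  push_cast
  rfl

lemma param_pos (hN : ∀ j, 2 ≤ N j) : ∀ i ∈ paramSet N, 0 < param N i := by
  intro i hi
  have h1 := residues_pos_lt (hN i.1) (Finset.mem_sigma.1 hi).2
  exact div_pos (by exact_mod_cast h1.1) (by have := hN i.1; positivity)

lemma param_lt_one (hN : ∀ j, 2 ≤ N j) : ∀ i ∈ paramSet N, param N i < 1 := by
  intro i hi
  have h1 := residues_pos_lt (hN i.1) (Finset.mem_sigma.1 hi).2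
  rw [param, div_lt_one (by have := hN i.1; positivity)]
  exact_mod_cast h1.2

lemma B_eq (N : Fin k → ℕ) (m : ℕ) : B N m = (C N : ℝ) ^ m * pochSeq (paramSet N) (param N) m := by
  simp only [B, B1, C, pochSeq, paramSet, Finset.prod_sigma, Finset.prod_mul_distrib, param]
  rw [Nat.cast_prod, Finset.prod_pow]

lemma H_eq (hN : ∀ j, 2 ≤ N j) (m : ℕ) : H N m = harmSeq (paramSet N) (param N) m := by
  rw [harmSeq, paramSet, Finset.sum_sigma, H]
  refine Finset.sum_congr rfl fun j _ => ?_
  rw [H1, Finset.sum_sub_distrib, Finset.sum_const, card_residues (hN j), nsmul_eq_mul]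
  rfl

lemma C_pos (hN : ∀ j, 2 ≤ N j) : (0 : ℝ) < C N := by
  have : 0 < C N := Finset.prod_pos fun j _ => Nat.mul_pos
    (pow_pos (by have := hN j; omega) _)
    (Finset.prod_pos fun p hp => pow_pos (Nat.prime_of_mem_primeFactors hp).pos _)
  exact_mod_cast this

lemma tendsto_harmSeq_param (hN : ∀ j, 2 ≤ N j) :
    Tendsto (harmSeq (paramSet N) (param N)) atTop (𝓝 (Real.log (C N))) := by
  have h1 : Tendsto (fun m => ∑ j, H1 (N j) m) atTop (𝓝 (∑ j, Real.log (C1 (N j)))) :=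
    tendsto_finsetSum _ fun j _ => tendsto_H1 (by have := hN j; omega)
  have hC := (C_pos hN).ne'
  rw [C, Nat.cast_prod] at hC ⊢
  rw [Real.log_prod fun j hj => (Finset.prod_ne_zero_iff.1 hC) j hj]
  exact h1.congr fun m => H_eq hN m

lemma Phi_pos (hk : 1 ≤ k) (hN : ∀ j, 2 ≤ N j) : 0 < Phi N :=
  Finset.sum_pos (fun j _ => Nat.totient_pos.2 (by have := hN j; omega))
    ⟨⟨0, hk⟩, Finset.mem_univ _⟩

lemma C_eq_four (hk : 1 ≤ k) (hN : ∀ j, 2 ≤ N j) (h : Phi N = 1) : C N = 4 := by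
  have h1 : k ≤ 1 := by
    rw [← h]
    have : ∑ _j : Fin k, 1 ≤ Phi N :=
      Finset.sum_le_sum fun j _ => Nat.totient_pos.2 (by have := hN j; omega)
    simpa using this
  obtain rfl : k = 1 := le_antisymm h1 hk
  have h2 : (N 0).totient = 1 := by simpa [Phi] using h
  have h3 : N 0 = 2 := by
    have := hN 0
    rcases Nat.totient_eq_one_iff.1 h2 with h | h <;> omega
  simp [C, C1, h3, Nat.prime_two.primeFactors]

/-- The coefficients of `q` in terms of those of the exponential. -/
def qCoeff (c : ℝ) (e : ℕ → ℝ) (n : ℕ) : ℝ := if n = 0 then 0 else c ^ (n - 1) * e (n - 1)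

lemma isSumOn_q (hN : ∀ j, 2 ≤ N j) {e : ℕ → ℝ}
    (he : IsSumOn (fun n => (e n : ℂ)) (fun z => Complex.exp
      ((∑' n, ((harmSeq (paramSet N) (param N) n * pochSeq (paramSet N) (param N) n : ℝ) : ℂ) *
        z ^ n) / ∑' n, (pochSeq (paramSet N) (param N) n : ℂ) * z ^ n)) 1) :
    IsSumOn (fun n => (qCoeff (C N) e n : ℂ)) (q N) (1 / (C N : ℝ)) := by
  intro z hz
  have hC := C_pos hN
  have hw : ‖(C N : ℂ) * z‖ < 1 := by
    rw [norm_mul, Complex.norm_natCast, mul_comm]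
    rwa [lt_div_iff₀ hC] at hz
  have h1 := (he _ hw).mul_left z
  have hF : F N z = ∑' n, (pochSeq (paramSet N) (param N) n : ℂ) * ((C N : ℂ) * z) ^ n := by
    rw [F]
    congr 1
    funext n
    rw [B_eq, mul_pow]
    push_cast
    ring
  have hG : G N z = ∑' n, ((harmSeq (paramSet N) (param N) n *
      pochSeq (paramSet N) (param N) n : ℝ) : ℂ) * ((C N : ℂ) * z) ^ n := by
    rw [G]
    congr 1
    funext n
    rw [B_eq, H_eq hN, mul_pow]
    push_cast
    ring
  rw [← hasSum_nat_add_iff' 1]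
  simp only [Finset.range_one, Finset.sum_singleton, qCoeff, if_true, Complex.ofReal_zero, zero_mul,
    sub_zero, q, hF, hG]
  refine h1.congr_fun fun n => ?_
  simp only [Nat.add_eq_zero_iff, one_ne_zero, and_false, if_false, Nat.add_sub_cancel, mul_pow]
  push_cast
  ring

lemma qCoeff_nonneg {c : ℝ} {e : ℕ → ℝ} (hc : 0 ≤ c) (he : ∀ n, 0 ≤ e n) (n : ℕ) :
    0 ≤ qCoeff c e n := by
  rw [qCoeff]
  split_ifs
  · exact le_rfl
  · exact mul_nonneg (pow_nonneg hc _) (he _)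

lemma qCoeff_succ (c : ℝ) (e : ℕ → ℝ) (n : ℕ) : qCoeff c e (n + 1) = c ^ n * e n := by
  simp [qCoeff]

lemma qCoeff_succ_mul {c : ℝ} (hc : 0 < c) (e : ℕ → ℝ) (n : ℕ) :
    qCoeff c e (n + 1) * (1 / c) ^ (n + 1) = e n / c := by
  rw [qCoeff_succ, pow_succ, div_pow, one_pow]
  field_simp

lemma sum_qCoeff_le_one {c : ℝ} (hc : 0 < c) {e : ℕ → ℝ}
    (hs : ∀ n, ∑ i ∈ Finset.range n, e i ≤ c) (n : ℕ) :
    ∑ i ∈ Finset.range n, qCoeff c e i * (1 / c) ^ i ≤ 1 := by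
  rcases n with _ | n
  · simp
  rw [Finset.sum_range_succ']
  simp only [qCoeff_succ_mul hc, ← Finset.sum_div]
  rw [qCoeff, if_pos rfl, zero_mul, add_zero, div_le_one hc]
  exact hs n

lemma isEquivalent_ofReal {u v : ℕ → ℝ} (hv : ∀ᶠ n in atTop, v n ≠ 0)
    (h : Tendsto (fun n => u n / v n) atTop (𝓝 1)) :
    (fun n => (u n : ℂ)) ~[atTop] (fun n => (v n : ℂ)) := by
  have hv' : ∀ᶠ n in atTop, (v n : ℂ) ≠ 0 := hv.mono fun n hn => by exact_mod_cast hn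
  rw [isEquivalent_iff_tendsto_one hv']
  have h1 := (Complex.continuous_ofReal.tendsto 1).comp h
  rw [Complex.ofReal_one] at h1
  refine h1.congr fun n => ?_
  simp

lemma qCoeff_isEquivalent_rpow {c a s : ℝ} {e : ℕ → ℝ} (hc : 0 < c) (ha : 0 < a)
    (h : Tendsto (fun n : ℕ => e n / ((n : ℝ) + 1) ^ (-s)) atTop (𝓝 a)) :
    (fun n => (qCoeff c e n : ℂ)) ~[atTop]
      (fun n : ℕ => ((a / c * (c ^ n / (n : ℝ) ^ s) : ℝ) : ℂ)) := by
  refine isEquivalent_ofReal ?_ ?_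
  · filter_upwards [eventually_gt_atTop 0] with n hn
    have : (0 : ℝ) < n := by exact_mod_cast hn
    positivity
  · rw [← tendsto_add_atTop_iff_nat 1]
    have h1 := h.div_const a
    rw [div_self ha.ne'] at h1
    -- The factor z in q shifts the index by one, so one power of `c` is lost and the constant is `a
    -- / c`.
    refine h1.congr fun n => ?_
    have h2 : (0 : ℝ) < ((n : ℝ) + 1) ^ s := by positivity
    rw [qCoeff_succ, Real.rpow_neg (by positivity), pow_succ]
    push_cast
    field_simp

lemma qCoeff_isEquivalent_log {c a : ℝ} {e : ℕ → ℝ} (hc : 0 < c) (ha : 0 < a)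
    (h : Tendsto (fun n : ℕ => e n / (1 / Real.log ((n : ℝ) + 2) ^ 2 / ((n : ℝ) + 1))) atTop
      (𝓝 a)) :
    (fun n => (qCoeff c e n : ℂ)) ~[atTop]
      (fun n : ℕ => ((a / c * (c ^ n / ((n : ℝ) * Real.log n ^ 2)) : ℝ) : ℂ)) := by
  refine isEquivalent_ofReal ?_ ?_
  · filter_upwards [eventually_gt_atTop 1] with n hn
    have h1 : (1 : ℝ) < n := by exact_mod_cast hn
    have h2 := Real.log_pos h1
    positivity
  · rw [← tendsto_add_atTop_iff_nat 2]
    have h1 := ((h.comp (tendsto_add_atTop_nat 1)).mul isTempered_logWeight.ratio).div_const a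
    rw [mul_one, div_self ha.ne'] at h1
    refine h1.congr fun n => ?_
    have h3 := log_add_two_pos n
    have h4 := log_add_two_pos (n + 1)
    rw [show n + 2 = n + 1 + 1 from rfl, qCoeff_succ, pow_succ c (n + 1)]
    simp only [Function.comp]
    push_cast at h4 ⊢
    rw [show (n : ℝ) + 1 + 1 = n + 2 by ring]
    field_simp

lemma not_summable_of_tendsto {e w : ℕ → ℝ} {a : ℝ} {j : ℕ} (hw : ∀ n, 0 < w n) (ha : 0 < a)
    (h : Tendsto (fun n => e n / w n) atTop (𝓝 a))
    (hj : ∀ᶠ n : ℕ in atTop, 1 ≤ ((n : ℝ) + 1) ^ j * w n) :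
    ¬ Summable (fun n : ℕ => ((n : ℝ) + 1) ^ j * e n) := by
  intro hs
  have h1 := hs.tendsto_atTop_zero.eventually_lt_const (half_pos ha)
  have h2 := h.eventually_const_lt (half_lt_self ha)
  obtain ⟨n, hn1, hn2, hn3⟩ := (h1.and (h2.and hj)).exists
  have hwn := hw n
  rw [lt_div_iff₀ hwn] at hn2
  have h3 : ((n : ℝ) + 1) ^ j * (a / 2 * w n) ≤ ((n : ℝ) + 1) ^ j * e n :=
    mul_le_mul_of_nonneg_left hn2.le (by positivity)
  have h4 := mul_le_mul_of_nonneg_left hn3 (half_pos ha).le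
  linarith

lemma not_summable_rpow {e : ℕ → ℝ} {a s : ℝ} {j : ℕ} (hj : s ≤ j) (ha : 0 < a)
    (h : Tendsto (fun n : ℕ => e n / ((n : ℝ) + 1) ^ (-s)) atTop (𝓝 a)) :
    ¬ Summable (fun n : ℕ => ((n : ℝ) + 1) ^ j * e n) := by
  refine not_summable_of_tendsto (fun n => by positivity) ha h (Eventually.of_forall fun n => ?_)
  rw [← Real.rpow_natCast, ← Real.rpow_add (by positivity)]
  exact Real.one_le_rpow (by linarith [n.cast_nonneg (α := ℝ)]) (by linarith)

lemma not_summable_log {e : ℕ → ℝ} {a : ℝ} (ha : 0 < a)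
    (h : Tendsto (fun n : ℕ => e n / (1 / Real.log ((n : ℝ) + 2) ^ 2 / ((n : ℝ) + 1))) atTop
      (𝓝 a)) :
    ¬ Summable (fun n : ℕ => ((n : ℝ) + 1) ^ 2 * e n) := by
  refine not_summable_of_tendsto (isTempered_succ_inv_mul isTempered_logWeight).pos ha h ?_
  filter_upwards [tendsto_succ_mul_logWeight.eventually_ge_atTop 1] with n hn
  refine hn.trans (le_of_eq ?_)
  have := log_add_two_pos n
  field_simp

/-- An analytic continuation would make ∑ n^j times the terms at 1/C_N converge for every j; after
the index shift this contradicts the assumed divergence. -/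
lemma hasSingularityAt_q (hN : ∀ j, 2 ≤ N j) {e : ℕ → ℝ} {j : ℕ} (he : ∀ n, 0 ≤ e n)
    (hq : IsSumOn (fun n => (qCoeff (C N) e n : ℂ)) (q N) (1 / (C N : ℝ)))
    (hj : ¬ Summable (fun n : ℕ => ((n : ℝ) + 1) ^ j * e n)) :
    HasSingularityAt (q N) (Metric.ball 0 (1 / (C N : ℝ))) (1 / (C N : ℂ)) := by
  have hC := C_pos hN
  have hcast : (1 / (C N : ℂ)) = ((1 / (C N : ℝ) : ℝ) : ℂ) := by push_cast; rfl
  refine ⟨?_, ?_⟩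
  · rw [frontier_ball _ (by positivity), mem_sphere_zero_iff_norm, hcast, Complex.norm_real,
      Real.norm_of_nonneg (by positivity)]
  · rintro ⟨g, hg, hqg⟩
    rw [hcast] at hg hqg
    refine hj ?_
    have h1 := summable_of_analyticAt (by positivity) j
      (qCoeff_nonneg hC.le he) hq hg hqg
    have h2 := ((summable_nat_add_iff 1).2 h1).mul_right (C N : ℝ)
    refine h2.congr fun n => ?_
    rw [qCoeff_succ_mul hC]
    push_cast
    field_simp

/-- With a larger radius the sum of the series would itself be an analytic continuation at 1/C_N. -/
lemma radius_eq (hN : ∀ j, 2 ≤ N j) {a : ℕ → ℂ} (hq : IsSumOn a (q N) (1 / (C N : ℝ)))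
    (hs : HasSingularityAt (q N) (Metric.ball 0 (1 / (C N : ℝ))) (1 / (C N : ℂ))) :
    (FormalMultilinearSeries.ofScalars ℂ a).radius = ENNReal.ofReal (1 / (C N : ℝ)) := by
  have hC := C_pos hN
  have hball := hq.hasFPowerSeriesOnBall (by positivity)
  refine le_antisymm (le_of_not_gt fun hlt => hs.2 ?_) hball.r_le
  set p := FormalMultilinearSeries.ofScalars ℂ a
  have hp := p.hasFPowerSeriesOnBall (hball.r_pos.trans hlt)
  refine ⟨p.sum, hp.analyticAt_of_mem ?_, ?_⟩
  · have h1 : ‖(1 / (C N : ℂ))‖ = 1 / (C N : ℝ) := by simp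
    rw [Metric.mem_eball, edist_zero_right, ← ofReal_norm, h1]
    exact hlt
  · filter_upwards [self_mem_nhdsWithin] with z hz
    have hz' : z ∈ Metric.eball (0 : ℂ) (ENNReal.ofReal (1 / (C N : ℝ))) := by
      rwa [Metric.eball_ofReal]
    have h1 := hball.hasSum hz'
    have h2 := hp.hasSum (Metric.eball_subset_eball hlt.le hz')
    rw [zero_add] at h1 h2
    exact h1.unique h2

end assembly

end CanonicalCoordinate

end

theorem theorem2 (k : ℕ) (hk : 1 ≤ k) (N : Fin k → ℕ) (hN : ∀ j, 2 ≤ N j) :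
    -- (i) the Taylor series represents the function on the open disk, has radius of convergence
    -- `1 / C_N`, and converges (absolutely) on the boundary circle
    (HasFPowerSeriesOnBall (CanonicalCoordinate.q N)
        (CanonicalCoordinate.taylorSeries (CanonicalCoordinate.q N)) 0
        (ENNReal.ofReal (1 / (CanonicalCoordinate.C N : ℝ))) ∧
      (CanonicalCoordinate.taylorSeries (CanonicalCoordinate.q N)).radius =
        ENNReal.ofReal (1 / (CanonicalCoordinate.C N : ℝ)) ∧
      ∀ z : ℂ, ‖z‖ = 1 / (CanonicalCoordinate.C N : ℝ) →
        Summable (fun m : ℕ =>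
          CanonicalCoordinate.taylorCoeff (CanonicalCoordinate.q N) m * z ^ m)) ∧
    -- (ii) singularity at `1 / C_N`
    CanonicalCoordinate.HasSingularityAt (CanonicalCoordinate.q N)
      (Metric.ball 0 (1 / (CanonicalCoordinate.C N : ℝ)))
      (1 / (CanonicalCoordinate.C N : ℂ)) ∧
    -- (iii) the bound by `1` on the closed disk; on the boundary circle the value `w` of the
    -- function is the sum of the Taylor series, equivalently the limit from inside the disk
    ((∀ z : ℂ, ‖z‖ < 1 / (CanonicalCoordinate.C N : ℝ) → ‖CanonicalCoordinate.q N z‖ ≤ 1) ∧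
      ∀ z : ℂ, ‖z‖ = 1 / (CanonicalCoordinate.C N : ℝ) →
        ∃ w : ℂ,
          HasSum (fun m : ℕ =>
            CanonicalCoordinate.taylorCoeff (CanonicalCoordinate.q N) m * z ^ m) w ∧
          Tendsto (CanonicalCoordinate.q N)
            (𝓝[Metric.ball 0 (1 / (CanonicalCoordinate.C N : ℝ))] z) (𝓝 w) ∧
          ‖w‖ ≤ 1) ∧
    -- (iv)
    (CanonicalCoordinate.Phi N = 1 →
      (∀ m : ℕ, 1 ≤ m →
        CanonicalCoordinate.taylorCoeff (CanonicalCoordinate.q N) m = (catalan m : ℂ)) ∧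
      (fun m : ℕ => CanonicalCoordinate.taylorCoeff (CanonicalCoordinate.q N) m) ~[atTop]
        (fun m : ℕ => (((4 : ℝ) ^ m / (√Real.pi * (m : ℝ) ^ ((3 : ℝ) / 2)) : ℝ) : ℂ))) ∧
    -- (v)
    (CanonicalCoordinate.Phi N = 2 →
      ∃ c : ℝ, c ≠ 0 ∧
        (fun m : ℕ => CanonicalCoordinate.taylorCoeff (CanonicalCoordinate.q N) m) ~[atTop]
          (fun m : ℕ =>
            ((c * ((CanonicalCoordinate.C N : ℝ) ^ m / ((m : ℝ) * Real.log m ^ 2)) : ℝ) : ℂ))) ∧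
    -- (vi)
    (3 ≤ CanonicalCoordinate.Phi N →
      ∃ c : ℝ, c ≠ 0 ∧
        (fun m : ℕ => CanonicalCoordinate.taylorCoeff (CanonicalCoordinate.q N) m) ~[atTop]
          (fun m : ℕ =>
            ((c * ((CanonicalCoordinate.C N : ℝ) ^ m /
              (m : ℝ) ^ ((CanonicalCoordinate.Phi N : ℝ) / 2)) : ℝ) : ℂ))) := by
  open CanonicalCoordinate in
  set s := paramSet N with hs
  set x := param N with hx
  have hC := C_pos hN
  have hR : (0 : ℝ) < 1 / (C N : ℝ) := by positivity
  have hcard : s.card = Phi N := card_paramSet hN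
  have hsum : ∑ i ∈ s, x i = (s.card : ℝ) / 2 := sum_param hN
  have hx0 : ∀ i ∈ s, 0 < x i := param_pos hN
  have hx1 : ∀ i ∈ s, x i < 1 := param_lt_one hN
  have hL : Tendsto (harmSeq s x) atTop (𝓝 (Real.log (C N))) := tendsto_harmSeq_param hN
  have hPhi := Phi_pos hk hN
  have hK := isKaluzaPair_pochSeq (Finset.card_pos.1 (hcard ▸ hPhi)) hx0 hx1 hL
  obtain ⟨e, he0, hrec, hsumE⟩ := exists_exp_coeff hK.isSumOn_quot hK.quot_zero
  have he := hK.exp_nonneg he0 hrec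
  -- The bound exp L equals C_N exactly; this is what produces the constant 1 in (iii).
  have hle : ∀ n, ∑ i ∈ Finset.range n, e i ≤ C N := fun n => by
    have := hK.sum_exp_le he hsumE n
    rwa [Real.exp_log hC] at this
  have hes : Summable e := summable_of_sum_range_le he hle
  have hq : IsSumOn (fun n => (qCoeff (C N) e n : ℂ)) (q N) (1 / (C N : ℝ)) := isSumOn_q hN hsumE
  have hqc : taylorCoeff (q N) = fun n => (qCoeff (C N) e n : ℂ) := hq.taylorCoeff_eq hR
  have hq0 := qCoeff_nonneg hC.le he
  have hqle := sum_qCoeff_le_one hC hle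
  have hqs : Summable (fun n => qCoeff (C N) e n * (1 / (C N : ℝ)) ^ n) :=
    summable_of_sum_range_le (fun n => mul_nonneg (hq0 n) (by positivity)) hqle
  have hq1 : ∑' n, qCoeff (C N) e n * (1 / (C N : ℝ)) ^ n ≤ 1 :=
    Real.tsum_le_of_sum_range_le (fun n => mul_nonneg (hq0 n) (by positivity)) hqle
  have hbound : ∀ (z w : ℂ), ‖z‖ ≤ 1 / (C N : ℝ) →
      HasSum (fun n => (qCoeff (C N) e n : ℂ) * z ^ n) w → ‖w‖ ≤ 1 := by
    intro z w hz hw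
    rw [← hw.tsum_eq]
    refine (tsum_of_norm_bounded hqs.hasSum fun n => ?_).trans hq1
    rw [norm_mul, norm_pow, Complex.norm_real, Real.norm_of_nonneg (hq0 n)]
    exact mul_le_mul_of_nonneg_left (pow_le_pow_left₀ (norm_nonneg z) hz n) (hq0 n)
  have hcat : Phi N = 1 → ∀ n, e n = (catalan (n + 1) : ℝ) / 4 ^ n := by
    intro h1
    obtain ⟨i, hi⟩ := Finset.card_eq_one.1 (hcard.trans h1)
    have hxi : x i = 1 / 2 := by
      rw [hi, Finset.sum_singleton, Finset.card_singleton] at hsum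
      simpa using hsum
    refine eq_catalan_of_half (pochSeq_zero s x) (fun n => ?_) (fun n => ?_) he0 hrec
    · rw [pochSeq_succ, hi, Finset.prod_singleton, hxi]
    · rw [harmSeq_succ, hi, Finset.sum_singleton, hxi]
  have hasym1 : Phi N = 1 → Tendsto (fun n : ℕ => e n / ((n : ℝ) + 1) ^ (-(3 / 2 : ℝ))) atTop
      (𝓝 (4 / √Real.pi)) := fun h1 => by
    simpa only [hcat h1] using tendsto_catalan
  have hpi : 0 < 4 / √Real.pi := by have := Real.pi_pos; positivity
  have hasym2 : Phi N = 2 → ∃ c, 0 < c ∧ Tendsto (fun n : ℕ =>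
      e n / (1 / Real.log ((n : ℝ) + 2) ^ 2 / ((n : ℝ) + 1))) atTop (𝓝 c) := fun h2 =>
    exists_tendsto_exp_log hx0 hx1 hsum (hcard.trans h2) hL he0 he hes hrec
  have hasym3 : 3 ≤ Phi N → ∃ c, 0 < c ∧ Tendsto (fun n : ℕ =>
      e n / ((n : ℝ) + 1) ^ (-((Phi N : ℝ) / 2))) atTop (𝓝 c) := fun h3 => by
    have := exists_tendsto_exp_rpow hx0 hx1 hsum (hcard ▸ h3) hL he0 he hes hrec
    rwa [hcard] at this
  -- The exponent j only has to reach the decay rate: 3/2, 1 with log², and Φ/2 respectively.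
  have hns : ∃ j : ℕ, ¬ Summable (fun n : ℕ => ((n : ℝ) + 1) ^ j * e n) := by
    rcases (by omega : Phi N = 1 ∨ Phi N = 2 ∨ 3 ≤ Phi N) with h | h | h
    · exact ⟨2, not_summable_rpow (by norm_num) hpi (hasym1 h)⟩
    · obtain ⟨c, hc, hlim⟩ := hasym2 h
      exact ⟨2, not_summable_log hc hlim⟩
    · obtain ⟨c, hc, hlim⟩ := hasym3 h
      exact ⟨Phi N, not_summable_rpow (by linarith [(Phi N).cast_nonneg (α := ℝ)]) hc hlim⟩
  obtain ⟨j, hj⟩ := hns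
  have hsing := hasSingularityAt_q hN he hq hj
  have hboundary : ∀ z : ℂ, ‖z‖ = 1 / (C N : ℝ) → ∃ w : ℂ,
      HasSum (fun n => (qCoeff (C N) e n : ℂ) * z ^ n) w ∧
      Tendsto (q N) (𝓝[Metric.ball 0 (1 / (C N : ℝ))] z) (𝓝 w) :=
    fun z hz => exists_boundary_value hq0 hq hqs hz
  rw [taylorSeries, hqc]
  refine ⟨⟨hq.hasFPowerSeriesOnBall hR, radius_eq hN hq hsing, fun z hz => ?_⟩, hsing,
    ⟨fun z hz => hbound z _ hz.le (hq z hz), fun z hz => ?_⟩, fun h1 => ⟨fun m hm => ?_, ?_⟩,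
    fun h2 => ?_, fun h3 => ?_⟩
  · obtain ⟨w, hw, -⟩ := hboundary z hz
    exact hw.summable
  · obtain ⟨w, hw, hlim⟩ := hboundary z hz
    exact ⟨w, hw, hlim, hbound z w hz.le hw⟩
  · obtain ⟨n, rfl⟩ := Nat.exists_eq_add_of_le' hm
    beta_reduce
    rw [qCoeff_succ, hcat h1, C_eq_four hk hN h1]
    push_cast
    field_simp
  · have h := qCoeff_isEquivalent_rpow hC hpi (hasym1 h1)
    convert h using 3 with m
    rw [C_eq_four hk hN h1]
    push_cast
    field_simp
  · obtain ⟨c, hc, hlim⟩ := hasym2 h2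
    exact ⟨c / C N, (div_pos hc hC).ne', qCoeff_isEquivalent_log hC hc hlim⟩
  · obtain ⟨c, hc, hlim⟩ := hasym3 h3
    exact ⟨c / C N, (div_pos hc hC).ne', qCoeff_isEquivalent_rpow hC hc hlim⟩
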